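/- Let $\pi/2<\alpha<\pi$, $\omega_0>0$, ${\bf n}=(\cos(\pi+\alpha),\sin(\pi+\alpha))$, $\overline{\bf n}=(n_1,-n_2)$, $\varphi_\pm=\pi\pm\alpha$, and let $Q=\mathbb R^2\setminus\{(x_1,0):x_1\ge 0\}$, with polar coordinates $x=(\rho\cos\varphi,\rho\sin\varphi)$, $0\le\varphi<2\pi$. Let $f\in L^1_{loc}(\mathbb R)$ be complex-valued with $f(s)=0$ for $s<0$, $\sup_s(1+|s|)^p|f(s)|<\infty$ for some $p\in\mathbb R$, and $\lim_{s\to+\infty}f(s)=1$, and put $F(s)=f(s)e^{-i\omega_0 s}$. For $\varphi\ne\varphi_\pm$ define the incident wave $u_i(x,t)=F(t-{\bf n}\cdot x)$, its screened version $u_i^0=u_i$ for $\varphi<\varphi_+$ and $u_i^0=0$ for $\varphi>\varphi_+$, the reflected wave $u_r(x,t)=-F(t-\overline{\bf n}\cdot x)$ for $\varphi<\varphi_-$ and $u_r=0$ for $\varphi>\varphi_-$, and the diffracted wave $$u_d(\rho,\varphi,t)=\frac{i}{8\pi}\int_{\mathbb R}Z(\beta+2\pi i-i\varphi)\,F(t-\rho\cosh\beta)\,d\beta,$$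 where $Z(z)=-U(-\tfrac{i\pi}{2}+z)+U(-\tfrac{5i\pi}{2}+z)$ and $U(\zeta)=\coth\big(\tfrac14(\zeta-\tfrac{i\pi}{2}+i\alpha)\big)-\coth\big(\tfrac14(\zeta-\tfrac{i\pi}{2}-i\alpha)\big)$. The scattered wave is $u_s:=u_i^0+u_r+u_d-u_i$. Let $\mathbb C^+=\{\operatorname{Im}\omega>0\}$, and let $\mathcal M$ be the space of tempered distributions $u(x,t)$ on $\mathbb R^2\times\mathbb R$ supported in $\overline Q\times[0,\infty)$ whose Fourier--Laplace transform in time $\hat u(\cdot,\omega)=\int_0^\infty e^{i\omega t}u(\cdot,t)\,dt$ (understood as $\langle\hat u(\cdot,\omega),\psi\rangle=\langle u,\psi(x)e^{i\omega t}\rangle$) is given by a holomorphic function of $\omega\in\mathbb C^+$ with values in $C^2(Q)$, with $\hat u(\cdot,\omega)\in H^1(Q)$ for every $\omega\in\mathbb C^+$. Then: (i) for every $\omega\in\mathbb C^+$ the integral $\hat u_s(x,\omega)=\int_0^\infty e^{i\omega t}u_s(x,t)\,dt$ converges absolutely for every $x\in Q$ with $\varphi\ne\varphi_\pm$, and $\hat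 u_s(\cdot,\omega)\in H^1(Q)$; (ii) $u_s\in\mathcal M$; that is, integration against the function $u_s$ defines a tempered distribution on $\mathbb R^2\times\mathbb R$, and this distribution belongs to $\mathcal M$. -/

import Mathlib

open Filter Topology MeasureTheory Set
open scoped SchwartzMap

noncomputable section

namespace HalfPlaneDiffraction

/-- The plane `ℝ²` with its Euclidean norm. -/
abbrev Plane := EuclideanSpace ℝ (Fin 2)

/-! ### Geometry -/

/-- The screen `W⁰`: the closed half-line `x₂ = 0`, `x₁ ≥ 0`. -/
def screen : Set Plane := {x | 0 ≤ x 0 ∧ x 1 = 0}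

/-- The domain `Q`, the complement of the screen. -/
def Q : Set Plane := screenᶜ

/-- The polar angle `φ ∈ [0, 2π)` of a point; the polar radius is the norm `‖x‖`. -/
def polarAngle (x : Plane) : ℝ :=
  if 0 ≤ Complex.arg ⟨x 0, x 1⟩ then Complex.arg ⟨x 0, x 1⟩
  else Complex.arg ⟨x 0, x 1⟩ + 2 * Real.pi

/-- The critical angle `φ₊ = π + α`. -/
def phiPlus (α : ℝ) : ℝ := Real.pi + α

/-- The critical angle `φ₋ = π - α`. -/
def phiMinus (α : ℝ) : ℝ := Real.pi - α

/-! ### The profile function and the waves -/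

/-- Admissible profile functions. -/
structure IsProfile (f : ℝ → ℂ) : Prop where
  locallyIntegrable : LocallyIntegrable f volume
  eq_zero_of_neg : ∀ s < 0, f s = 0
  bounded : ∃ p : ℝ, BddAbove (range fun s : ℝ => (1 + |s|) ^ p * ‖f s‖)
  tendsto_one : Tendsto f atTop (𝓝 1)

/-- `F(s) = f(s) e^{-iω₀s}`. -/
def modulated (ω₀ : ℝ) (f : ℝ → ℂ) (s : ℝ) : ℂ :=
  f s * Complex.exp (-Complex.I * ω₀ * s)

/-- The phase `n · x` of the incident wave, `n = (cos (π + α), sin (π + α))`. -/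
def incidentPhase (α : ℝ) (x : Plane) : ℝ :=
  Real.cos (Real.pi + α) * x 0 + Real.sin (Real.pi + α) * x 1

/-- The phase `n̄ · x` of the reflected wave, `n̄ = (n₁, -n₂)`. -/
def reflectedPhase (α : ℝ) (x : Plane) : ℝ :=
  Real.cos (Real.pi + α) * x 0 - Real.sin (Real.pi + α) * x 1

/-- The incident plane wave `u_i(x,t) = e^{-iω₀(t - n·x)} f(t - n·x)`. -/
def incidentWave (α ω₀ : ℝ) (f : ℝ → ℂ) (x : Plane) (t : ℝ) : ℂ :=
  modulated ω₀ f (t - incidentPhase α x)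

/-- The incident wave in the presence of the opaque screen: `u_i` for `φ < φ₊` and `0` for
`φ > φ₊`. -/
def screenedIncidentWave (α ω₀ : ℝ) (f : ℝ → ℂ) (x : Plane) (t : ℝ) : ℂ :=
  if polarAngle x < phiPlus α then incidentWave α ω₀ f x t else 0

/-- The reflected wave: `-e^{-iω₀(t - n̄·x)} f(t - n̄·x)` for `φ < φ₋` and `0` for `φ > φ₋`.
It vanishes for `t < 0`, since `n̄ · x ≥ 0` for `φ < φ₋` and `f` vanishes on the negative axis. -/
def reflectedWave (α ω₀ : ℝ) (f : ℝ → ℂ) (x : Plane) (t : ℝ) : ℂ :=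
  if polarAngle x < phiMinus α then -modulated ω₀ f (t - reflectedPhase α x) else 0

/-- The complex hyperbolic cotangent. -/
def coth (z : ℂ) : ℂ := Complex.cosh z / Complex.sinh z

/-- The kernel `U(ζ) = coth (q(ζ - iπ/2 + iα)) - coth (q(ζ - iπ/2 - iα))`, `q = 1/4`. -/
def kernelU (α : ℝ) (ζ : ℂ) : ℂ :=
  coth ((1 / 4) * (ζ - Complex.I * Real.pi / 2 + Complex.I * α)) -
    coth ((1 / 4) * (ζ - Complex.I * Real.pi / 2 - Complex.I * α))

/-- The kernel `Z(z) = -U(-iπ/2 + z) + U(-5iπ/2 + z)`. -/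
def kernelZ (α : ℝ) (z : ℂ) : ℂ :=
  -kernelU α (-(Complex.I * Real.pi / 2) + z) + kernelU α (-(5 * Complex.I * Real.pi / 2) + z)

/-- The diffracted wave
`u_d(ρ,φ,t) = (i / 8π) ∫_ℝ Z(β + 2πi - iφ) F(t - ρ cosh β) dβ`. -/
def diffractedWave (α ω₀ : ℝ) (f : ℝ → ℂ) (x : Plane) (t : ℝ) : ℂ :=
  Complex.I / (8 * Real.pi) *
    ∫ β : ℝ, kernelZ α (β + 2 * Real.pi * Complex.I - Complex.I * polarAngle x) *
      modulated ω₀ f (t - ‖x‖ * Real.cosh β)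

/-- The total field `u = u_i⁰ + u_r + u_d`. -/
def totalWave (α ω₀ : ℝ) (f : ℝ → ℂ) (x : Plane) (t : ℝ) : ℂ :=
  screenedIncidentWave α ω₀ f x t + reflectedWave α ω₀ f x t + diffractedWave α ω₀ f x t

/-- The scattered wave `u_s = u - u_i`. -/
def scatteredWave (α ω₀ : ℝ) (f : ℝ → ℂ) (x : Plane) (t : ℝ) : ℂ :=
  totalWave α ω₀ f x t - incidentWave α ω₀ f x t

/-! ### Function spaces -/

/-- The Fourier–Laplace transform `ĥ(ω) = ∫₀^∞ e^{iωt} h(t) dt` of a function of time. -/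
def fourierLaplace (h : ℝ → ℂ) (ω : ℂ) : ℂ :=
  ∫ t in Ioi (0 : ℝ), Complex.exp (Complex.I * ω * t) * h t

/-- Membership in the Sobolev space `H¹(Ω)`: `v` is in `L²(Ω)` and has weak first-order partial
derivatives in `L²(Ω)`. -/
def MemH1 (Ω : Set Plane) (v : Plane → ℂ) : Prop :=
  MemLp v 2 (volume.restrict Ω) ∧
    ∀ k : Fin 2, ∃ g : Plane → ℂ, MemLp g 2 (volume.restrict Ω) ∧
      ∀ θ : Plane → ℂ, ContDiff ℝ ((⊤ : ℕ∞) : WithTop ℕ∞) θ → HasCompactSupport θ → tsupport θ ⊆ Ω →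
        ∫ x in Ω, v x * fderiv ℝ θ x (EuclideanSpace.single k 1) = -∫ x in Ω, g x * θ x

/-- `V` is a holomorphic function on the upper half-plane with values in the Fréchet space
`C²(Ω)` (uniform convergence on compact subsets of `Ω` of the derivatives of order `≤ 2`):
the difference quotients converge in `C²(Ω)` at every point of the upper half-plane. -/
def IsHolomorphicIntoC2 (Ω : Set Plane) (V : ℂ → Plane → ℂ) : Prop :=
  (∀ ω : ℂ, 0 < ω.im → ContDiffOn ℝ 2 (V ω) Ω) ∧
    ∀ ω : ℂ, 0 < ω.im → ∃ W : Plane → ℂ, ContDiffOn ℝ 2 W Ω ∧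
      ∀ K : Set Plane, IsCompact K → K ⊆ Ω → ∀ j ≤ 2,
        TendstoUniformlyOn
          (fun (η : ℂ) x => iteratedFDeriv ℝ j (fun y => (η - ω)⁻¹ * (V η y - V ω y)) x)
          (iteratedFDeriv ℝ j W) (𝓝[≠] ω) K

/-- `T ∈ S'(Ω̄ × [0,∞))`: a tempered distribution on `ℝ² × ℝ` supported in `Ω̄ × [0,∞)`. -/
def IsSupportedInFuture (Ω : Set Plane) (T : 𝓢'(Plane × ℝ, ℂ)) : Prop :=
  Distribution.IsVanishingOn T (closure Ω ×ˢ Ici (0 : ℝ))ᶜ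

/-- `Φ` is a Schwartz function on space-time that coincides with `ψ(x) e^{iωt}` on a
neighbourhood `t > -δ` of the closed half-line of times `t ≥ 0`. -/
def IsLaplaceTest (ω : ℂ) (ψ : 𝓢(Plane, ℂ)) (Φ : 𝓢(Plane × ℝ, ℂ)) : Prop :=
  ∃ δ > 0, ∀ (x : Plane) (t : ℝ), -δ < t → Φ (x, t) = ψ x * Complex.exp (Complex.I * ω * t)

/-- A smooth function of time that equals `e^{iωt}` for `t > -1/2` and `0` for `t < -1`. -/
def cutoffExp (ω : ℂ) (t : ℝ) : ℂ :=
  (Real.smoothTransition (2 * t + 2) : ℂ) * Complex.exp (Complex.I * ω * t)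

theorem contDiff_cutoffExp (ω : ℂ) : ContDiff ℝ ((⊤ : ℕ∞) : WithTop ℕ∞) (cutoffExp ω) := by
  unfold cutoffExp
  refine ContDiff.mul (Complex.ofRealCLM.contDiff.comp
    (Real.smoothTransition.contDiff.comp (by fun_prop))) ?_
  exact ContDiff.cexp (contDiff_const.mul Complex.ofRealCLM.contDiff)

theorem iteratedDeriv_exp_mul (c : ℂ) (n : ℕ) :
    iteratedDeriv n (fun t : ℝ => Complex.exp (c * t)) =
      fun t : ℝ => c ^ n * Complex.exp (c * t) := by
  induction n with
  | zero => simp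
  | succ n ih =>
    rw [iteratedDeriv_succ, ih]
    funext t
    have h1 : HasDerivAt (fun s : ℝ => c * (s : ℂ)) (c * 1) t :=
      (Complex.ofRealCLM.hasDerivAt (x := t)).const_mul c
    have h := (h1.cexp).const_mul (c ^ n)
    rw [h.deriv]
    ring

theorem cutoffExp_decay {ω : ℂ} (hω : 0 < ω.im) (k n : ℕ) :
    ∃ C, ∀ t : ℝ, ‖t‖ ^ k * ‖iteratedFDeriv ℝ n (cutoffExp ω) t‖ ≤ C := by
  have hcont : Continuous fun t : ℝ => ‖t‖ ^ k * ‖iteratedFDeriv ℝ n (cutoffExp ω) t‖ :=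
    (continuous_norm.pow k).mul
      ((contDiff_cutoffExp ω).continuous_iteratedFDeriv (m := n) (by exact_mod_cast le_top)).norm
  have hzero : ∀ t : ℝ, t < -1 → iteratedFDeriv ℝ n (cutoffExp ω) t = 0 := by
    intro t ht
    have he : cutoffExp ω =ᶠ[𝓝 t] fun _ => (0 : ℂ) := by
      filter_upwards [Iio_mem_nhds ht] with s hs
      have hs' : s < -1 := hs
      simp [cutoffExp, Real.smoothTransition.zero_of_nonpos (x := 2 * s + 2) (by linarith)]
    rw [(Filter.EventuallyEq.iteratedFDeriv ℝ he n).eq_of_nhds]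
    simp
  have hexp : ∀ t : ℝ, 0 ≤ t → ‖iteratedFDeriv ℝ n (cutoffExp ω) t‖ =
      ‖ω‖ ^ n * Real.exp (-(ω.im * t)) := by
    intro t ht
    have he : cutoffExp ω =ᶠ[𝓝 t] fun s : ℝ => Complex.exp (Complex.I * ω * s) := by
      filter_upwards [Ioi_mem_nhds (show (-(1 / 2) : ℝ) < t by linarith)] with s hs
      have hs' : -(1 / 2) < s := hs
      simp [cutoffExp, Real.smoothTransition.one_of_one_le (x := 2 * s + 2) (by linarith)]
    rw [(Filter.EventuallyEq.iteratedFDeriv ℝ he n).eq_of_nhds, norm_iteratedFDeriv_eq_norm_iteratedDeriv,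
      iteratedDeriv_exp_mul]
    simp [Complex.norm_exp]
  obtain ⟨C₁, hC₁⟩ := isCompact_Icc.bddAbove_image
    (hcont.continuousOn (s := Icc (-1 : ℝ) 0))
  have hlim : Tendsto (fun t : ℝ => t ^ k * Real.exp (-(ω.im * t))) atTop (𝓝 0) := by
    have h := tendsto_rpow_mul_exp_neg_mul_atTop_nhds_zero (k : ℝ) ω.im hω
    refine h.congr fun t => ?_
    simp
  have hb : ∃ C, ∀ t : ℝ, 0 ≤ t → t ^ k * Real.exp (-(ω.im * t)) ≤ C := by
    obtain ⟨N, hN⟩ := (hlim.eventually_le_const (show (0 : ℝ) < 1 by norm_num)).exists_forall_of_atTop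
    obtain ⟨C, hC⟩ := isCompact_Icc.bddAbove_image
      ((by fun_prop : Continuous fun t : ℝ => t ^ k * Real.exp (-(ω.im * t))).continuousOn
        (s := Icc (0 : ℝ) N))
    refine ⟨max C 1, fun t ht => ?_⟩
    rcases le_total t N with h | h
    · exact (hC ⟨t, ⟨ht, h⟩, rfl⟩).trans (le_max_left _ _)
    · exact (hN t h).trans (le_max_right _ _)
  obtain ⟨C₂, hC₂⟩ := hb
  refine ⟨max (max C₁ 0) (‖ω‖ ^ n * C₂), fun t => ?_⟩
  rcases lt_or_ge t (-1) with h | h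
  · rw [hzero t h]
    simp
  rcases le_total t 0 with h0 | h0
  · exact (hC₁ ⟨t, ⟨h, h0⟩, rfl⟩).trans ((le_max_left _ _).trans (le_max_left _ _))
  · rw [hexp t h0, Real.norm_of_nonneg h0]
    refine le_trans ?_ (le_max_right _ _)
    calc t ^ k * (‖ω‖ ^ n * Real.exp (-(ω.im * t)))
        = ‖ω‖ ^ n * (t ^ k * Real.exp (-(ω.im * t))) := by ring
      _ ≤ ‖ω‖ ^ n * C₂ := by gcongr; exact hC₂ t h0

/-- The product `ψ(x) g(t)` of two Schwartz functions is a Schwartz function. -/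
def tensor (ψ : 𝓢(Plane, ℂ)) (g : 𝓢(ℝ, ℂ)) : 𝓢(Plane × ℝ, ℂ) where
  toFun z := ψ z.1 * g z.2
  smooth' := ((ψ.smooth ⊤).comp contDiff_fst).mul ((g.smooth ⊤).comp contDiff_snd)
  decay' k n := by
    have hψ := fun i => ψ.decay k i
    have hψ0 := fun i => ψ.decay 0 i
    have hg := fun i => g.decay k i
    have hg0 := fun i => g.decay 0 i
    choose A hA using hψ
    choose A0 hA0 using hψ0
    choose B hB using hg
    choose B0 hB0 using hg0
    refine ⟨∑ i ∈ Finset.range (n + 1), (n.choose i : ℝ) *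
      (A i * B0 (n - i) + A0 i * B (n - i)), fun z => ?_⟩
    have h1 := norm_iteratedFDeriv_mul_le (𝕜 := ℝ) (N := ((⊤ : ℕ∞) : WithTop ℕ∞))
      ((ψ.smooth ⊤).comp (contDiff_fst (E := Plane) (F := ℝ)))
      ((g.smooth ⊤).comp (contDiff_snd (E := Plane) (F := ℝ))) z (n := n)
      (by exact_mod_cast le_top)
    have hfst : ∀ i, ‖iteratedFDeriv ℝ i (ψ ∘ (Prod.fst : Plane × ℝ → Plane)) z‖ ≤
        ‖iteratedFDeriv ℝ i ψ z.1‖ := by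
      intro i
      have := (ContinuousLinearMap.fst ℝ Plane ℝ).iteratedFDeriv_comp_right (ψ.smooth ⊤) z
        (i := i) (by exact_mod_cast le_top)
      simp only [ContinuousLinearMap.coe_fst'] at this
      rw [this]
      refine (ContinuousMultilinearMap.norm_compContinuousLinearMap_le _ _).trans ?_
      refine mul_le_of_le_one_right (norm_nonneg _) ?_
      exact Finset.prod_le_one (fun _ _ => norm_nonneg _)
        (fun _ _ => ContinuousLinearMap.norm_fst_le ℝ Plane ℝ)
    have hsnd : ∀ i, ‖iteratedFDeriv ℝ i (g ∘ (Prod.snd : Plane × ℝ → ℝ)) z‖ ≤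
        ‖iteratedFDeriv ℝ i g z.2‖ := by
      intro i
      have := (ContinuousLinearMap.snd ℝ Plane ℝ).iteratedFDeriv_comp_right (g.smooth ⊤) z
        (i := i) (by exact_mod_cast le_top)
      simp only [ContinuousLinearMap.coe_snd'] at this
      rw [this]
      refine (ContinuousMultilinearMap.norm_compContinuousLinearMap_le _ _).trans ?_
      refine mul_le_of_le_one_right (norm_nonneg _) ?_
      exact Finset.prod_le_one (fun _ _ => norm_nonneg _)
        (fun _ _ => ContinuousLinearMap.norm_snd_le ℝ Plane ℝ)
    have hz : ‖z‖ ^ k ≤ ‖z.1‖ ^ k + ‖z.2‖ ^ k := by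
      rw [Prod.norm_def]
      rcases max_choice ‖z.1‖ ‖z.2‖ with h | h <;> rw [h] <;>
        linarith [pow_nonneg (norm_nonneg z.1) k, pow_nonneg (norm_nonneg z.2) k]
    refine (mul_le_mul_of_nonneg_left h1 (by positivity)).trans ?_
    rw [Finset.mul_sum]
    refine Finset.sum_le_sum fun i _ => ?_
    have a := (hA i).2 z.1
    have a0 := (hA0 i).2 z.1
    have b := (hB (n - i)).2 z.2
    have b0 := (hB0 (n - i)).2 z.2
    simp only [pow_zero, one_mul] at a0 b0
    set p := ‖iteratedFDeriv ℝ i ψ z.1‖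
    set q := ‖iteratedFDeriv ℝ (n - i) g z.2‖
    have hp : 0 ≤ p := norm_nonneg _
    have hq : 0 ≤ q := norm_nonneg _
    have hpq := mul_le_mul (hfst i) (hsnd (n - i)) (norm_nonneg _) hp
    calc ‖z‖ ^ k * ((n.choose i : ℝ) * ‖iteratedFDeriv ℝ i (ψ ∘ Prod.fst) z‖ *
          ‖iteratedFDeriv ℝ (n - i) (g ∘ Prod.snd) z‖)
        = (n.choose i : ℝ) * (‖z‖ ^ k * (‖iteratedFDeriv ℝ i (ψ ∘ Prod.fst) z‖ *
          ‖iteratedFDeriv ℝ (n - i) (g ∘ Prod.snd) z‖)) := by ring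
      _ ≤ (n.choose i : ℝ) * ((‖z.1‖ ^ k + ‖z.2‖ ^ k) * (p * q)) := by gcongr
      _ = (n.choose i : ℝ) * ((‖z.1‖ ^ k * p) * q + p * (‖z.2‖ ^ k * q)) := by ring
      _ ≤ (n.choose i : ℝ) * (A i * B0 (n - i) + A0 i * B (n - i)) := by
          have hAi : 0 ≤ A i := le_trans (by positivity) a
          have hA0i : 0 ≤ A0 i := hp.trans a0
          gcongr

theorem exists_isLaplaceTest {ω : ℂ} (hω : 0 < ω.im) (ψ : 𝓢(Plane, ℂ)) :
    ∃ Φ, IsLaplaceTest ω ψ Φ := by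
  let g : 𝓢(ℝ, ℂ) := ⟨cutoffExp ω, contDiff_cutoffExp ω, fun k n => cutoffExp_decay hω k n⟩
  refine ⟨tensor ψ g, 1 / 2, by norm_num, fun x t ht => ?_⟩
  change ψ x * cutoffExp ω t = _
  simp [cutoffExp, Real.smoothTransition.one_of_one_le (x := 2 * t + 2) (by linarith)]

/-- The Fourier–Laplace transform with respect to time, at `ω`, of the distribution `T` supported
in `t ≥ 0` is the function `v` on `Ω`: `⟨T, ψ(x) e^{iωt}⟩ = ∫_Ω v ψ dx` for all `ψ`.
Since `T` is supported in `t ≥ 0`, the left-hand side is computed with any Schwartz function that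
coincides with `ψ(x) e^{iωt}` near `t ≥ 0`; such functions exist by `exists_isLaplaceTest`. -/
def HasFourierLaplace (Ω : Set Plane) (T : 𝓢'(Plane × ℝ, ℂ)) (ω : ℂ) (v : Plane → ℂ) : Prop :=
  ∀ (ψ : 𝓢(Plane, ℂ)) (Φ : 𝓢(Plane × ℝ, ℂ)), IsLaplaceTest ω ψ Φ →
    T Φ = ∫ x in Ω, v x * ψ x

/-- The class `𝓜` of `u ∈ S'(Q̄ × [0,∞))` whose Fourier–Laplace transform `û(·,ω)` is a
holomorphic function of `ω` in the upper half-plane with values in `C²(Q)`, such that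
`û(·,ω) ∈ H¹(Q)` for every `ω` in the upper half-plane. -/
def solutionClass : Set 𝓢'(Plane × ℝ, ℂ) :=
  {T | IsSupportedInFuture Q T ∧ ∃ V : ℂ → Plane → ℂ,
    (∀ ω : ℂ, 0 < ω.im → HasFourierLaplace Q T ω (V ω)) ∧
    IsHolomorphicIntoC2 Q V ∧
    ∀ ω : ℂ, 0 < ω.im → MemH1 Q (V ω)}

/-- The function `u(x,t)` is, as a tempered distribution, the distribution `T`. -/
def IsRegularDistribution (T : 𝓢'(Plane × ℝ, ℂ)) (u : Plane → ℝ → ℂ) : Prop :=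
  ∀ Φ : 𝓢(Plane × ℝ, ℂ),
    Integrable (fun z : Plane × ℝ => u z.1 z.2 * Φ z) volume ∧
      T Φ = ∫ z : Plane × ℝ, u z.1 z.2 * Φ z

end HalfPlaneDiffraction

end

open HalfPlaneDiffraction

noncomputable section

namespace HalfPlaneDiffraction

/-! The scattered wave splits into two pieces, one for each critical ray `φ = θ`, `θ = φ₊, φ₋`.
Their transforms in time are explicit, extend analytically across the rays and decay exponentially
in space.

The identity `coth_sub_coth_sub_pi_div_two` turns `kernelZ` into a difference of kernels `2 / sinh
((β - i(φ - θ)) / 2)`. The signal depends on `β` only through `cosh β`, so only the even part of the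
kernel counts, and the substitution `σ = sinh (β/2) / |sin ((φ - θ)/2)|` turns it into the Cauchy
density `1 / (1 + σ²)`. With `r = √ρ sin ((φ - θ)/2)` one has `ρ cosh β = ρ + 2r²σ²` and `ρ cos (φ -
θ) = ρ - 2r²`. So each piece is an `edgeWave`: the sign of `r` times a Cauchy average of delayed
signals, minus a plane wave where `r > 0` (for `φ₋`, `r` is replaced by `-r`); this is
`scatteredWave_eq`.

In the transform the jump of the sign cancels the jump of the plane wave: by `transition_mul_ofReal`
the result is the transform of the signal times `e^{iωρ}` times the entire function `transition` at
`(-2iω)^{1/2} r`. Since `r` is the imaginary part of a rotated holomorphic square root on `Q`, the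
transform is real analytic in `(ω, x)` and holomorphic in `ω`, which gives holomorphy into `C²`.

A plane wave is present only within the angle `π - α < π/2` of its ray, so its phase is at least
`-cos α · ρ`. Hence the transform decays exponentially; its gradient costs at most a factor of order
`1 + ρ^{-1/2}`, still square integrable in the plane. The same phase inequality gives causality and
polynomial growth in `t`, hence a tempered distribution, whose transform is found by Fubini.

Finally `f` is only locally integrable. It is replaced by a Borel representative (`IsTame`), because
translations and `β ↦ t - ρ cosh β` pull null sets back to null sets. -/

section HolomorphicFamiliesC2

open scoped ContDiff

/-! ### Holomorphic families of real analytic functions. -/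

section HolomorphicFamilies

variable {E : Type*} [NormedAddCommGroup E] [NormedSpace ℝ E]

/-- The slice is `H` composed with `y ↦ (ζ, 0) + inr y`, so the chain rule for affine maps applies.
The exponent `ω` is the real analytic smoothness class. -/
theorem iteratedFDeriv_section {H : ℂ × E → ℂ} {S : Set (ℂ × E)} (hS : IsOpen S)
    (hH : ContDiffOn ℝ ω H S) {ζ : ℂ} {x : E} (hz : (ζ, x) ∈ S) (j : ℕ) :
    iteratedFDeriv ℝ j (fun y => H (ζ, y)) x =
      (iteratedFDeriv ℝ j H (ζ, x)).compContinuousLinearMap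
        (fun _ => ContinuousLinearMap.inr ℝ ℂ E) := by
  set T : Set (ℂ × E) := (fun z => (ζ, (0 : E)) + z) ⁻¹' S with hT
  have hTo : IsOpen T := hS.preimage (by fun_prop)
  have hG : ContDiffOn ℝ ω (fun z => H ((ζ, (0 : E)) + z)) T :=
    hH.comp (by fun_prop) (fun z hz => hz)
  have hx : ContinuousLinearMap.inr ℝ ℂ E x ∈ T := by simpa [hT] using hz
  have hpre : IsOpen (ContinuousLinearMap.inr ℝ ℂ E ⁻¹' T) :=
    hTo.preimage (ContinuousLinearMap.continuous _)
  have h := (ContinuousLinearMap.inr ℝ ℂ E).iteratedFDerivWithin_comp_right hG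
    hTo.uniqueDiffOn hpre.uniqueDiffOn hx (i := j) (by exact_mod_cast le_top)
  rw [iteratedFDerivWithin_of_isOpen j hpre hx, iteratedFDerivWithin_of_isOpen j hTo hx,
    iteratedFDeriv_comp_add_left] at h
  simpa [Function.comp_def] using h

/-- On the factor `ℂ` the real derivative is the restriction of scalars of the complex one, hence
complex linear. -/
theorem fderiv_holomorphic_direction {H : ℂ × E → ℂ} {z : ℂ × E}
    (hH : DifferentiableAt ℝ H z) (hol : DifferentiableAt ℂ (fun η => H (η, z.2)) z.1) (ζ : ℂ) :
    fderiv ℝ H z (ζ, 0) = ζ * fderiv ℝ H z (1, 0) := by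
  have h1 : HasFDerivAt (fun η : ℂ => H (η, z.2))
      ((fderiv ℝ H z).comp (ContinuousLinearMap.inl ℝ ℂ E)) z.1 := by
    have : HasFDerivAt (fun η : ℂ => (η, z.2)) (ContinuousLinearMap.inl ℝ ℂ E) z.1 :=
      hasFDerivAt_prodMk_left z.1 z.2
    exact HasFDerivAt.comp (g := H) z.1 (f := fun η : ℂ => (η, z.2)) hH.hasFDerivAt this
  have h2 := hol.hasFDerivAt.restrictScalars ℝ
  have h3 := h1.unique h2
  have h4 : ∀ v : ℂ, fderiv ℝ H z (v, 0) = fderiv ℂ (fun η => H (η, z.2)) z.1 v := fun v => by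
    simpa using congrArg (fun L => L v) h3
  rw [h4, h4]
  simp

/-- Derivatives in `ζ` and in `x` commute, and holomorphy makes the `ζ`-derivative a multiplication
by a complex number. -/
theorem hasFDerivAt_iteratedFDeriv_section {H : ℂ × E → ℂ} {S : Set (ℂ × E)} (hS : IsOpen S)
    (hH : ContDiffOn ℝ ω H S) (hol : ∀ z ∈ S, DifferentiableAt ℂ (fun η => H (η, z.2)) z.1)
    {ζ : ℂ} {x : E} (hz : (ζ, x) ∈ S) (j : ℕ) :
    HasFDerivAt (fun η : ℂ => iteratedFDeriv ℝ j (fun y => H (η, y)) x)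
      ((ContinuousLinearMap.id ℝ ℂ).smulRight
        (iteratedFDeriv ℝ j (fun y => fderiv ℝ H (ζ, y) (1, 0)) x)) ζ := by
  have hat : ∀ z ∈ S, ContDiffAt ℝ ω H z := fun z hz => hH.contDiffAt (hS.mem_nhds hz)
  have hfd : ContDiffOn ℝ ω (fderiv ℝ H) S := hH.fderiv_of_isOpen hS (by simp)
  have hD : ContDiffOn ℝ ω (fun z => fderiv ℝ H z (1, 0)) S := hfd.clm_apply contDiffOn_const
  have h1 : HasFDerivAt (fun η : ℂ => (η, x)) (ContinuousLinearMap.inl ℝ ℂ E) ζ :=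
    hasFDerivAt_prodMk_left ζ x
  have h2 : DifferentiableAt ℝ (iteratedFDeriv ℝ j H) (ζ, x) :=
    ((hat _ hz).iteratedFDeriv_right (m := 1) (i := j) (by simp)).differentiableAt (by simp)
  have h3 := (ContinuousMultilinearMap.compContinuousLinearMapL (𝕜 := ℝ) (F := ℂ)
    (fun _ : Fin j => ContinuousLinearMap.inr ℝ ℂ E)).hasFDerivAt.comp ζ
    (HasFDerivAt.comp (g := iteratedFDeriv ℝ j H) ζ (f := fun η : ℂ => (η, x)) h2.hasFDerivAt h1)
  have h4 := h3.congr_of_eventuallyEq (f₁ := fun η : ℂ => iteratedFDeriv ℝ j (fun y => H (η, y)) x)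
    (by
      have : ∀ᶠ η in 𝓝 ζ, (η, x) ∈ S :=
        (show ContinuousAt (fun η : ℂ => (η, x)) ζ by fun_prop) (hS.mem_nhds hz)
      filter_upwards [this] with η hη
      exact iteratedFDeriv_section hS hH hη j)
  refine h4.congr_fderiv (Eq.symm ?_)
  refine ContinuousLinearMap.ext fun c => ContinuousMultilinearMap.ext fun v => ?_
  -- Symmetry of the derivative of order `j + 1` moves the direction `(c, 0)` from the first slot
  -- (differentiate in `ζ` last) to the last slot (differentiate in `ζ` first).
  have hperm := (hat _ hz).iteratedFDeriv_comp_perm (n := j + 1)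
    (Fin.cons (c, (0 : E)) (fun i => ContinuousLinearMap.inr ℝ ℂ E (v i))) (finRotate (j + 1))
  have hsn := Fin.snoc_eq_cons_rotate (fun i => ContinuousLinearMap.inr ℝ ℂ E (v i)) (c, (0 : E))
  have hperm' : iteratedFDeriv ℝ (j + 1) H (ζ, x)
        (Fin.cons (c, (0 : E)) (fun i => ContinuousLinearMap.inr ℝ ℂ E (v i))) =
      iteratedFDeriv ℝ (j + 1) H (ζ, x) (Fin.snoc (α := fun _ => ℂ × E)
        (fun i => ContinuousLinearMap.inr ℝ ℂ E (v i)) (c, (0 : E))) := by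
    rw [hsn]; exact hperm.symm
  rw [iteratedFDeriv_succ_apply_left, iteratedFDeriv_succ_apply_right] at hperm'
  rw [Fin.init_snoc (α := fun _ => ℂ × E), Fin.snoc_last (α := fun _ => ℂ × E),
    Fin.cons_zero, Fin.tail_cons] at hperm'
  have hL := (ContinuousLinearMap.apply ℝ ℂ (c, (0 : E))).iteratedFDeriv_comp_left
    (hfd.contDiffAt (hS.mem_nhds hz)) (i := j) (by exact_mod_cast le_top)
  have hev : (ContinuousLinearMap.apply ℝ ℂ (c, (0 : E)) ∘ fderiv ℝ H) =ᶠ[𝓝 (ζ, x)]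
      (c • fun z => fderiv ℝ H z (1, 0)) := by
    filter_upwards [hS.mem_nhds hz] with z hz
    simpa using fderiv_holomorphic_direction ((hat z hz).differentiableAt (by simp)) (hol z hz) c
  rw [(hev.iteratedFDeriv ℝ j).eq_of_nhds, iteratedFDeriv_const_smul_apply
    ((hD.contDiffAt (hS.mem_nhds hz)).of_le (by exact_mod_cast le_top))] at hL
  have hL' := congrArg (fun M => M (fun i => ContinuousLinearMap.inr ℝ ℂ E (v i))) hL
  simp only [ContinuousLinearMap.compContinuousMultilinearMap_coe, Function.comp_apply,
    ContinuousLinearMap.apply_apply] at hL'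
  rw [← hperm'] at hL'
  rw [iteratedFDeriv_section hS hD hz j]
  simpa using hL'

theorem continuousOn_iteratedFDeriv_section {H : ℂ × E → ℂ} {S : Set (ℂ × E)} (hS : IsOpen S)
    (hH : ContDiffOn ℝ ω H S) (j : ℕ) :
    ContinuousOn (fun z : ℂ × E => iteratedFDeriv ℝ j (fun y => H (z.1, y)) z.2) S := by
  have h1 : ContinuousOn (iteratedFDeriv ℝ j H) S := fun z hz =>
    (((hH.contDiffAt (hS.mem_nhds hz)).iteratedFDeriv_right (m := 0) (i := j)
      (by simp)).continuousAt).continuousWithinAt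
  have h2 := (ContinuousMultilinearMap.compContinuousLinearMapL (𝕜 := ℝ) (F := ℂ)
    (fun _ : Fin j => ContinuousLinearMap.inr ℝ ℂ E)).continuous.comp_continuousOn h1
  refine h2.congr fun z hz => ?_
  exact iteratedFDeriv_section hS hH hz j

/-- The difference quotients of a holomorphic family of analytic functions converge locally
uniformly together with all their derivatives. -/
theorem tendstoUniformlyOn_iteratedFDeriv_diffQuotient {H : ℂ × E → ℂ} {U : Set ℂ} {Ω : Set E}
    (hU : IsOpen U) (hΩ : IsOpen Ω) (hH : ContDiffOn ℝ ω H (U ×ˢ Ω))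
    (hol : ∀ z ∈ U ×ˢ Ω, DifferentiableAt ℂ (fun η => H (η, z.2)) z.1)
    {ζ : ℂ} (hζ : ζ ∈ U) {K : Set E} (hK : IsCompact K) (hKΩ : K ⊆ Ω) (j : ℕ) :
    TendstoUniformlyOn
      (fun (η : ℂ) x => iteratedFDeriv ℝ j (fun y => (η - ζ)⁻¹ * (H (η, y) - H (ζ, y))) x)
      (iteratedFDeriv ℝ j fun y => fderiv ℝ H (ζ, y) (1, 0)) (𝓝[≠] ζ) K := by
  have hS : IsOpen (U ×ˢ Ω) := hU.prod hΩ
  have hD : ContDiffOn ℝ ω (fun z => fderiv ℝ H z (1, 0)) (U ×ˢ Ω) :=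
    (hH.fderiv_of_isOpen hS (by simp)).clm_apply contDiffOn_const
  obtain ⟨r, hr, hrU⟩ := Metric.nhds_basis_closedBall.mem_iff.1 (hU.mem_nhds hζ)
  have hsub : Metric.closedBall ζ r ×ˢ K ⊆ U ×ˢ Ω := prod_mono hrU hKΩ
  have huc := ((isCompact_closedBall ζ r).prod hK).uniformContinuousOn_of_continuous
    ((continuousOn_iteratedFDeriv_section hS hD j).mono hsub)
  rw [Metric.uniformContinuousOn_iff] at huc
  rw [Metric.tendstoUniformlyOn_iff]
  intro ε hε
  obtain ⟨δ, hδ, hδ'⟩ := huc (ε / 2) (by positivity)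
  have hball : Metric.ball ζ (min δ r) ∈ 𝓝[≠] ζ :=
    mem_nhdsWithin_of_mem_nhds (Metric.ball_mem_nhds _ (lt_min hδ hr))
  filter_upwards [hball, self_mem_nhdsWithin] with η hη hne x hx
  have hηζ : η - ζ ≠ 0 := sub_ne_zero.2 hne
  have hBU : Metric.ball ζ (min δ r) ⊆ U := fun ξ hξ =>
    hrU (Metric.ball_subset_closedBall (Metric.ball_subset_ball (min_le_right _ _) hξ))
  set W := iteratedFDeriv ℝ j (fun y => fderiv ℝ H (ζ, y) (1, 0)) x with hW
  have hζS : (ζ, x) ∈ U ×ˢ Ω := ⟨hζ, hKΩ hx⟩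
  have hηS : (η, x) ∈ U ×ˢ Ω := ⟨hBU hη, hKΩ hx⟩
  have hsec : ∀ ξ : ℂ, (ξ, x) ∈ U ×ˢ Ω → ContDiffAt ℝ j (fun y => H (ξ, y)) x := fun ξ hξ =>
    ((hH.contDiffAt (hS.mem_nhds hξ)).of_le (by exact_mod_cast le_top)).comp x
      (f := fun y => (ξ, y)) (by fun_prop)
  have hlin : iteratedFDeriv ℝ j (fun y => (η - ζ)⁻¹ * (H (η, y) - H (ζ, y))) x =
      (η - ζ)⁻¹ • (iteratedFDeriv ℝ j (fun y => H (η, y)) x -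
        iteratedFDeriv ℝ j (fun y => H (ζ, y)) x) := by
    rw [← iteratedFDeriv_sub_apply (hsec η hηS) (hsec ζ hζS)]
    exact iteratedFDeriv_const_smul_apply (a := (η - ζ)⁻¹)
      (f := (fun y => H (η, y)) - fun y => H (ζ, y)) ((hsec η hηS).sub (hsec ζ hζS))
  -- Mean value inequality for `ξ ↦ D^j H(ξ, ·) - ξ W`: by uniform continuity on the compact product
  -- its derivative is at most `ε / 2` near `ζ`, uniformly for `x ∈ K`.
  have hmv := (convex_ball ζ (min δ r)).norm_image_sub_le_of_norm_hasFDerivWithin_le (𝕜 := ℝ)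
    (f := fun ξ : ℂ => iteratedFDeriv ℝ j (fun y => H (ξ, y)) x - ξ • W) (C := ε / 2)
    (f' := fun ξ => (ContinuousLinearMap.id ℝ ℂ).smulRight
        (iteratedFDeriv ℝ j (fun y => fderiv ℝ H (ξ, y) (1, 0)) x) -
        (ContinuousLinearMap.id ℝ ℂ).smulRight W)
    (fun ξ hξ => by
      refine HasFDerivAt.hasFDerivWithinAt (HasFDerivAt.sub ?_ ?_)
      · exact hasFDerivAt_iteratedFDeriv_section hS hH hol ⟨hBU hξ, hKΩ hx⟩ j
      · exact ((ContinuousLinearMap.id ℝ ℂ).smulRight W).hasFDerivAt)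
    (fun ξ hξ => by
      refine ContinuousLinearMap.opNorm_le_bound _ (by positivity) fun c => ?_
      have h := hδ' (ξ, x) ⟨Metric.ball_subset_closedBall
          (Metric.ball_subset_ball (min_le_right _ _) hξ), hx⟩ (ζ, x)
          ⟨Metric.mem_closedBall_self hr.le, hx⟩ (by
            rw [Prod.dist_eq]
            simpa using (Metric.mem_ball.1 hξ).trans_le (min_le_left _ _))
      rw [dist_eq_norm] at h
      simp only [sub_apply, ContinuousLinearMap.smulRight_apply,
        ContinuousLinearMap.id_apply]
      rw [← smul_sub, norm_smul, mul_comm]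
      exact mul_le_mul_of_nonneg_right h.le (norm_nonneg c))
    (Metric.mem_ball_self (lt_min hδ hr)) hη
  rw [hlin, dist_comm, dist_eq_norm]
  have hn : 0 < ‖η - ζ‖ := norm_pos_iff.2 hηζ
  have e : (η - ζ)⁻¹ • (iteratedFDeriv ℝ j (fun y => H (η, y)) x -
        iteratedFDeriv ℝ j (fun y => H (ζ, y)) x) - W =
      (η - ζ)⁻¹ • ((iteratedFDeriv ℝ j (fun y => H (η, y)) x - η • W) -
        (iteratedFDeriv ℝ j (fun y => H (ζ, y)) x - ζ • W)) := by
    rw [show (iteratedFDeriv ℝ j (fun y => H (η, y)) x - η • W) -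
        (iteratedFDeriv ℝ j (fun y => H (ζ, y)) x - ζ • W) =
        (iteratedFDeriv ℝ j (fun y => H (η, y)) x - iteratedFDeriv ℝ j (fun y => H (ζ, y)) x) -
          (η - ζ) • W by rw [sub_smul]; abel, smul_sub _ _ ((η - ζ) • W), smul_smul,
          inv_mul_cancel₀ hηζ, one_smul]
  rw [e, norm_smul, norm_inv]
  calc ‖η - ζ‖⁻¹ * _ ≤ ‖η - ζ‖⁻¹ * (ε / 2 * ‖η - ζ‖) := by gcongr
    _ = ε / 2 := by field_simp
    _ < ε := by linarith

end HolomorphicFamilies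

theorem isHolomorphicIntoC2_of_contDiffOn {Ω : Set Plane} (hΩ : IsOpen Ω) {H : ℂ × Plane → ℂ}
    (hH : ContDiffOn ℝ ω H ({z : ℂ | 0 < z.im} ×ˢ Ω))
    (hol : ∀ z ∈ {z : ℂ | 0 < z.im} ×ˢ Ω, DifferentiableAt ℂ (fun η => H (η, z.2)) z.1) :
    IsHolomorphicIntoC2 Ω (fun η x => H (η, x)) := by
  have hU : IsOpen {z : ℂ | 0 < z.im} := isOpen_lt continuous_const Complex.continuous_im
  refine ⟨fun ζ hζ => ?_, fun ζ hζ => ⟨fun x => fderiv ℝ H (ζ, x) (1, 0), ?_, ?_⟩⟩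
  · exact (hH.of_le le_top).comp (f := fun x => (ζ, x)) (by fun_prop) fun x hx => ⟨hζ, hx⟩
  · exact (((hH.fderiv_of_isOpen (hU.prod hΩ) (m := 2) (by simp)).clm_apply
      contDiffOn_const).comp (f := fun x => (ζ, x)) (by fun_prop) fun x hx => ⟨hζ, hx⟩)
  · intro K hK hKΩ j _
    exact tendstoUniformlyOn_iteratedFDeriv_diffQuotient hU hΩ hH hol hζ hK hKΩ j

end HolomorphicFamiliesC2

/-! ### Tempered distributions, membership in `H¹`, and a weighted `L²` majorant. -/

/-- A measurable function of polynomial growth is a tempered distribution. -/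
theorem exists_temperedDistribution_of_polynomial_growth {E : Type*} [NormedAddCommGroup E]
    [NormedSpace ℝ E] [MeasurableSpace E] [BorelSpace E] [SecondCountableTopology E]
    (μ : Measure E) [hμ : μ.HasTemperateGrowth] {u : E → ℂ} (hu : AEStronglyMeasurable u μ)
    {C : ℝ} {N : ℕ} (hC : 0 ≤ C) (hb : ∀ᵐ z ∂μ, ‖u z‖ ≤ C * (1 + ‖z‖) ^ N) :
    ∃ T : 𝓢'(E, ℂ), ∀ Φ : 𝓢(E, ℂ),
      Integrable (fun z => u z * Φ z) μ ∧ T Φ = ∫ z, u z * Φ z ∂μ := by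
  obtain ⟨n, hn⟩ := hμ.exists_integrable
  -- `N` powers of `1 + ‖z‖` absorb the growth of `u`, the other `n` provide integrability.
  let m : ℕ × ℕ := (N + n, 0)
  have key : ∀ Φ : 𝓢(E, ℂ), ∀ᵐ z ∂μ, ‖u z * Φ z‖ ≤ (1 + ‖z‖) ^ (-(n : ℝ)) *
      (C * (2 ^ (N + n) *
        ((Finset.Iic m).sup (fun m' => SchwartzMap.seminorm ℂ m'.1 m'.2) Φ))) := by
    intro Φ
    filter_upwards [hb] with z hz
    have h := SchwartzMap.one_add_le_sup_seminorm_apply (𝕜 := ℂ) (m := m) (k := N + n) (n := 0)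
      le_rfl le_rfl Φ z
    rw [norm_iteratedFDeriv_zero, pow_add] at h
    set S := (2 : ℝ) ^ (N + n) * ((Finset.Iic m).sup (fun m' => SchwartzMap.seminorm ℂ m'.1 m'.2) Φ)
    have hp : 0 < (1 + ‖z‖) ^ n := by positivity
    rw [norm_mul, Real.rpow_neg (by positivity), Real.rpow_natCast, inv_mul_eq_div, le_div_iff₀ hp]
    calc ‖u z‖ * ‖Φ z‖ * (1 + ‖z‖) ^ n ≤ C * (1 + ‖z‖) ^ N * ‖Φ z‖ * (1 + ‖z‖) ^ n := by gcongr
      _ = C * ((1 + ‖z‖) ^ N * (1 + ‖z‖) ^ n * ‖Φ z‖) := by ring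
      _ ≤ C * S := by gcongr
  have hint : ∀ Φ : 𝓢(E, ℂ), Integrable (fun z => u z * Φ z) μ := fun Φ =>
    (hn.mul_const _).mono' (hu.mul Φ.continuous.aestronglyMeasurable) (key Φ)
  let L : 𝓢(E, ℂ) →L[ℂ] ℂ := SchwartzMap.mkCLMtoNormedSpace (fun Φ => ∫ z, u z * Φ z ∂μ)
    (fun Φ Ψ => by
      rw [← integral_add (hint Φ) (hint Ψ)]
      congr 1; funext z; simp [mul_add])
    (fun a Φ => by
      rw [RingHom.id_apply, smul_eq_mul, ← integral_const_mul]
      congr 1; funext z; simp [mul_left_comm])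
    (by
      refine ⟨Finset.Iic m, (∫ z, (1 + ‖z‖) ^ (-(n : ℝ)) ∂μ) * (C * 2 ^ (N + n)),
        mul_nonneg (integral_nonneg fun z => by positivity) (by positivity), fun Φ => ?_⟩
      refine (norm_integral_le_of_norm_le (hn.mul_const _) (key Φ)).trans_eq ?_
      rw [integral_mul_const, show schwartzSeminormFamily ℂ E ℂ =
        fun m' => SchwartzMap.seminorm ℂ m'.1 m'.2 from rfl]
      ring)
  exact ⟨ContinuousLinearMap.toPointwiseConvergenceCLM _ _ _ _ L, fun Φ => ⟨hint Φ, rfl⟩⟩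

/-- A `C¹` function that is square integrable together with its classical partial derivatives
belongs to `H¹`. -/
theorem memH1_of_contDiffOn {Ω : Set Plane} (hΩ : IsOpen Ω) {v : Plane → ℂ}
    (hv : ContDiffOn ℝ 1 v Ω) (hL : MemLp v 2 (volume.restrict Ω))
    (hD : ∀ k : Fin 2,
      MemLp (fun x => fderiv ℝ v x (EuclideanSpace.single k 1)) 2 (volume.restrict Ω)) :
    MemH1 Ω v := by
  refine ⟨hL, fun k => ⟨_, hD k, fun θ hθ hθc hθs => ?_⟩⟩
  set e : Plane := EuclideanSpace.single k 1
  have hθ1 : ContDiff ℝ 1 θ := hθ.of_le (by exact_mod_cast le_top)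
  have hdc : Continuous fun x => fderiv ℝ θ x e :=
    (hθ1.continuous_fderiv (by simp)).clm_apply continuous_const
  have hdcs : HasCompactSupport fun x => fderiv ℝ θ x e := hθc.fderiv_apply ℝ e
  have hθL : MemLp θ 2 (volume.restrict Ω) :=
    (hθ1.continuous.memLp_of_hasCompactSupport hθc).restrict Ω
  have hdL : MemLp (fun x => fderiv ℝ θ x e) 2 (volume.restrict Ω) :=
    (hdc.memLp_of_hasCompactSupport hdcs).restrict Ω
  have h0 : ∀ x, x ∉ Ω → θ x = 0 := fun x hx =>
    image_eq_zero_of_notMem_tsupport fun h => hx (hθs h)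
  have hd0 : ∀ x, x ∉ Ω → fderiv ℝ θ x e = 0 := fun x hx => by
    have : fderiv ℝ θ x = 0 :=
      image_eq_zero_of_notMem_tsupport fun h => hx (hθs (tsupport_fderiv_subset ℝ h))
    simp [this]
  have ext : ∀ g h : Plane → ℂ, MemLp g 2 (volume.restrict Ω) → MemLp h 2 (volume.restrict Ω) →
      (∀ x, x ∉ Ω → h x = 0) → Integrable (fun x => g x * h x) := fun g h hg hh hz => by
    refine (integrableOn_iff_integrable_of_support_subset (s := Ω) fun x hx => ?_).1
      (hg.integrable_mul hh)
    by_contra hxΩ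
    exact hx (by simp [hz x hxΩ])
  rw [setIntegral_eq_integral_of_forall_compl_eq_zero fun x hx => by simp [hd0 x hx],
    setIntegral_eq_integral_of_forall_compl_eq_zero fun x hx => by simp [h0 x hx]]
  -- The integration by parts runs over the whole plane; differentiability of `v` is needed only on
  -- the support of `θ`, which lies in `Ω`.
  exact integral_mul_fderiv_eq_neg_fderiv_mul_of_integrable (ext _ _ (hD k) hθL h0)
    (ext _ _ hL hdL hd0) (ext _ _ hL hθL h0)
    (fun x hx => (hv.contDiffAt (hΩ.mem_nhds (hθs hx))).differentiableAt (by simp))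
    (fun x _ => hθ1.differentiable (by simp) x)

theorem memH1_congr {Ω : Set Plane} {v w : Plane → ℂ} (h : v =ᵐ[volume.restrict Ω] w)
    (hw : MemH1 Ω w) : MemH1 Ω v := by
  refine ⟨(memLp_congr_ae h).2 hw.1, fun k => ?_⟩
  obtain ⟨g, hg, hg'⟩ := hw.2 k
  refine ⟨g, hg, fun θ h1 h2 h3 => (integral_congr_ae ?_).trans (hg' θ h1 h2 h3)⟩
  filter_upwards [h] with x hx
  rw [hx]

/-- This function dominates the transformed wave and its gradient. The planar Jacobian compensates
the singularity: `r (1 + r^{-1/2})² = (√r + 1)² ≤ 2r + 2`. -/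
theorem memLp_two_radial {κ : ℝ} (hκ : 0 < κ) :
    MemLp (fun x : Plane => (1 + (√‖x‖)⁻¹) * Real.exp (-κ * ‖x‖)) 2 volume := by
  have hm : AEStronglyMeasurable
      (fun x : Plane => (1 + (√‖x‖)⁻¹) * Real.exp (-κ * ‖x‖)) volume := by
    apply Measurable.aestronglyMeasurable
    fun_prop
  rw [memLp_two_iff_integrable_sq hm,
    integrable_fun_norm_addHaar (μ := (volume : Measure Plane))
      (f := fun r => ((1 + (√r)⁻¹) * Real.exp (-κ * r)) ^ 2)]
  have h1 := integrableOn_rpow_mul_exp_neg_mul_rpow (p := 1) (s := 1) (b := 2 * κ)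
    (by norm_num) one_pos (by positivity)
  have h0 := integrableOn_rpow_mul_exp_neg_mul_rpow (p := 1) (s := 0) (b := 2 * κ)
    (by norm_num) one_pos (by positivity)
  refine ((h1.const_mul 2).add (h0.const_mul 2)).mono' ?_ ?_
  · apply Measurable.aestronglyMeasurable
    fun_prop
  · filter_upwards [ae_restrict_mem measurableSet_Ioi] with r hr
    have hr' : 0 < r := hr
    have hs : √r ^ 2 = r := Real.sq_sqrt hr'.le
    have hsp : 0 < √r := Real.sqrt_pos.2 hr'
    have e1 : r * (1 + (√r)⁻¹) ^ 2 = (√r + 1) ^ 2 := by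
      nth_rewrite 1 [← hs]
      field_simp
    have e2 : (√r + 1) ^ 2 ≤ 2 * r + 2 := by nlinarith [sq_nonneg (√r - 1)]
    have e3 : Real.exp (-κ * r) ^ 2 = Real.exp (-(2 * κ) * r) := by
      rw [← Real.exp_nat_mul]; congr 1; push_cast; ring
    simp only [finrank_euclideanSpace, Fintype.card_fin, Nat.reduceSub, pow_one, smul_eq_mul,
      Pi.add_apply, Real.rpow_one, Real.rpow_zero, one_mul]
    rw [Real.norm_of_nonneg (by positivity), mul_pow, ← mul_assoc, e1, e3]
    nlinarith [Real.exp_pos (-(2 * κ) * r)]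

/-! ### The transition function of a half-plane -/

theorem exists_gaussPrimitive :
    ∃ G : ℂ → ℂ, G 0 = 0 ∧ ∀ z, HasDerivAt G (Complex.exp (-z ^ 2)) z := by
  have h : Differentiable ℂ fun z : ℂ => Complex.exp (-z ^ 2) := by fun_prop
  obtain ⟨G, hG⟩ := h.isExactOn_univ
  exact ⟨fun z => G z - G 0, by simp, fun z => (hG z (mem_univ z)).sub_const _⟩

/-- The primitive of `e^{-z²}` that vanishes at the origin. -/
def gaussPrimitive : ℂ → ℂ := exists_gaussPrimitive.choose

theorem gaussPrimitive_zero : gaussPrimitive 0 = 0 := exists_gaussPrimitive.choose_spec.1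

theorem hasDerivAt_gaussPrimitive (z : ℂ) :
    HasDerivAt gaussPrimitive (Complex.exp (-z ^ 2)) z := exists_gaussPrimitive.choose_spec.2 z

theorem gaussPrimitive_neg (z : ℂ) : gaussPrimitive (-z) = -gaussPrimitive z := by
  have h : ∀ w, HasDerivAt (fun w => gaussPrimitive (-w) + gaussPrimitive w) 0 w := fun w => by
    have := ((hasDerivAt_gaussPrimitive (-w)).comp w (hasDerivAt_neg w)).add
      (hasDerivAt_gaussPrimitive w)
    refine this.congr_deriv ?_
    simp
  have := is_const_of_deriv_eq_zero (fun w => (h w).differentiableAt) (fun w => (h w).deriv) z 0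
  simp only [neg_zero, gaussPrimitive_zero, add_zero] at this
  exact eq_neg_of_add_eq_zero_left this

/-- The entire function `-e^{z²} (1/2 + π^{-1/2} ∫₀^z e^{-s²} ds)`. -/
def transition (z : ℂ) : ℂ := -(Complex.exp (z ^ 2) * (1 / 2 + gaussPrimitive z / √Real.pi))

theorem hasDerivAt_transition (z : ℂ) :
    HasDerivAt transition (2 * z * transition z - 1 / √Real.pi) z := by
  have h := ((((hasDerivAt_pow 2 z).cexp).mul
    (((hasDerivAt_gaussPrimitive z).div_const (√Real.pi : ℂ)).const_add (1 / 2))).neg)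
  refine h.congr_deriv ?_
  have e : Complex.exp (z ^ 2) * Complex.exp (-z ^ 2) = 1 := by
    rw [← Complex.exp_add]; simp
  unfold transition
  push_cast
  linear_combination (-(1 / (√Real.pi : ℂ))) * e

theorem differentiable_transition : Differentiable ℂ transition := fun z =>
  (hasDerivAt_transition z).differentiableAt

theorem transition_zero : transition 0 = -(1 / 2) := by
  simp [transition, gaussPrimitive_zero]

theorem norm_one_add_sq (σ : ℝ) : ‖(1 + (σ : ℂ) ^ 2)‖ = 1 + σ ^ 2 := by
  have h1 : (1 + (σ : ℂ) ^ 2) = ((1 + σ ^ 2 : ℝ) : ℂ) := by push_cast; ring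
  rw [h1, Complex.norm_real, Real.norm_of_nonneg (by positivity)]

theorem norm_cexp_neg_mul_sq_div_le {b : ℂ} (hb : 0 ≤ b.re) (σ : ℝ) :
    ‖Complex.exp (-b * (σ : ℂ) ^ 2) / (1 + (σ : ℂ) ^ 2)‖ ≤ (1 + σ ^ 2)⁻¹ := by
  rw [norm_div, norm_one_add_sq, div_eq_mul_inv, Complex.norm_exp, ← Complex.ofReal_pow,
    Complex.re_mul_ofReal, Complex.neg_re, neg_mul]
  refine mul_le_of_le_one_left (by positivity) (Real.exp_le_one_iff.2 ?_)
  exact neg_nonpos.2 (mul_nonneg hb (sq_nonneg σ))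

theorem integrable_cexp_neg_mul_sq_div {b : ℂ} (hb : 0 ≤ b.re) :
    Integrable fun σ : ℝ => Complex.exp (-b * (σ : ℂ) ^ 2) / (1 + (σ : ℂ) ^ 2) := by
  refine integrable_inv_one_add_sq.mono' ?_
    (Eventually.of_forall (norm_cexp_neg_mul_sq_div_le hb))
  apply Measurable.aestronglyMeasurable
  fun_prop

theorem norm_integral_cexp_neg_mul_sq_div_le {b : ℂ} (hb : 0 ≤ b.re) :
    ‖∫ σ : ℝ, Complex.exp (-b * (σ : ℂ) ^ 2) / (1 + (σ : ℂ) ^ 2)‖ ≤ Real.pi := by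
  rw [← integral_univ_inv_one_add_sq]
  exact norm_integral_le_of_norm_le integrable_inv_one_add_sq
    (Eventually.of_forall (norm_cexp_neg_mul_sq_div_le hb))

/-- `(2π)⁻¹ ∫ e^{-b r² (1 + σ²)} / (1 + σ²) dσ`. -/
def gaussCauchy (b : ℂ) (r : ℝ) : ℂ :=
  1 / (2 * Real.pi) *
    ∫ σ : ℝ, Complex.exp (-(b * r ^ 2) * (1 + (σ : ℂ) ^ 2)) / (1 + (σ : ℂ) ^ 2)

theorem gaussCauchy_eq (b : ℂ) (r : ℝ) :
    gaussCauchy b r = Complex.exp (-(b * r ^ 2)) * (1 / (2 * Real.pi) *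
      ∫ σ : ℝ, Complex.exp (-(b * r ^ 2) * (σ : ℂ) ^ 2) / (1 + (σ : ℂ) ^ 2)) := by
  rw [gaussCauchy, mul_left_comm, ← integral_const_mul (Complex.exp _)]
  congr 2
  funext σ
  rw [← mul_div_assoc, ← Complex.exp_add]
  ring_nf

theorem norm_cexp_one_add_sq (b : ℂ) (r σ : ℝ) :
    ‖Complex.exp (-(b * r ^ 2) * (1 + (σ : ℂ) ^ 2))‖ =
      Real.exp (-(b.re * r ^ 2 * (1 + σ ^ 2))) := by
  rw [Complex.norm_exp]
  have : (-(b * r ^ 2) * (1 + (σ : ℂ) ^ 2)) = ((-(r ^ 2 * (1 + σ ^ 2)) : ℝ) : ℂ) * b := by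
    push_cast; ring
  rw [this, Complex.re_ofReal_mul]
  ring_nf

theorem continuous_gaussCauchy {b : ℂ} (hb : 0 < b.re) : Continuous (gaussCauchy b) := by
  refine continuous_const.mul (continuous_of_dominated (bound := fun σ : ℝ => (1 + σ ^ 2)⁻¹)
    (fun r => ?_) (fun r => Eventually.of_forall fun σ => ?_) integrable_inv_one_add_sq
    (Eventually.of_forall fun σ => ?_))
  · apply Measurable.aestronglyMeasurable
    fun_prop
  · rw [norm_div, norm_one_add_sq, norm_cexp_one_add_sq, div_eq_mul_inv]
    refine mul_le_of_le_one_left (by positivity) (Real.exp_le_one_iff.2 ?_)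
    have : 0 ≤ b.re * r ^ 2 * (1 + σ ^ 2) := by positivity
    linarith
  · fun_prop

/-- Differentiation in `r` cancels the Cauchy denominator and leaves a Gaussian integral. The
domination uses `r > 0`: on `(r/2, 2r)` the Gaussian rate stays bounded below. -/
theorem hasDerivAt_gaussCauchy {b : ℂ} (hb : 0 < b.re) {r : ℝ} (hr : 0 < r) :
    HasDerivAt (gaussCauchy b) (1 / (2 * Real.pi) *
      (-(2 * b * r) * Complex.exp (-(b * r ^ 2)) * ∫ σ : ℝ, Complex.exp (-(b * r ^ 2) * σ ^ 2))) r := by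
  have hκ : 0 < b.re * (r / 2) ^ 2 := by positivity
  have h := (hasDerivAt_integral_of_dominated_loc_of_deriv_le (μ := volume)
    (F := fun (s : ℝ) (σ : ℝ) =>
      Complex.exp (-(b * s ^ 2) * (1 + (σ : ℂ) ^ 2)) / (1 + (σ : ℂ) ^ 2))
    (F' := fun (s : ℝ) (σ : ℝ) => -(2 * b * s) * Complex.exp (-(b * s ^ 2) * (1 + (σ : ℂ) ^ 2)))
    (bound := fun σ : ℝ => 2 * ‖b‖ * (2 * r) * Real.exp (-(b.re * (r / 2) ^ 2) * σ ^ 2))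
    (x₀ := r) (s := Ioo (r / 2) (2 * r)) (Ioo_mem_nhds (by linarith) (by linarith))
    (Eventually.of_forall fun s => by
      apply Measurable.aestronglyMeasurable
      fun_prop)
    (by
      have := (integrable_cexp_neg_mul_sq_div (b := b * r ^ 2) (by
        rw [← Complex.ofReal_pow, Complex.re_mul_ofReal]; positivity)).const_mul
          (Complex.exp (-(b * r ^ 2)))
      refine this.congr (Eventually.of_forall fun σ => ?_)
      simp only
      rw [← mul_div_assoc, ← Complex.exp_add]
      ring_nf)
    (by
      apply Measurable.aestronglyMeasurable
      fun_prop)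
    (Eventually.of_forall fun σ s hs => by
      have hs0 : 0 < s := by linarith [hs.1]
      rw [norm_mul, norm_cexp_one_add_sq, norm_neg, norm_mul, norm_mul, Complex.norm_real,
        Real.norm_of_nonneg hs0.le, Complex.norm_ofNat]
      refine mul_le_mul ?_ (Real.exp_le_exp.2 ?_) (Real.exp_pos _).le (by positivity)
      · exact mul_le_mul_of_nonneg_left hs.2.le (by positivity)
      · have h1 : (r / 2) ^ 2 ≤ s ^ 2 := pow_le_pow_left₀ (by positivity) hs.1.le 2
        have h2 : b.re * (r / 2) ^ 2 * σ ^ 2 ≤ b.re * s ^ 2 * (1 + σ ^ 2) := by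
          gcongr
          linarith
        linarith)
    ((integrable_exp_neg_mul_sq hκ).const_mul _)
    (Eventually.of_forall fun σ s hs => by
      have hne : (1 + (σ : ℂ) ^ 2) ≠ 0 := by
        rw [← norm_ne_zero_iff, norm_one_add_sq]; positivity
      have h1 : HasDerivAt (fun s : ℝ => (s : ℂ)) 1 s := Complex.ofRealCLM.hasDerivAt
      have h2 := (((((h1.pow 2).const_mul b).neg).mul_const (1 + (σ : ℂ) ^ 2)).cexp).div_const
        (1 + (σ : ℂ) ^ 2)
      refine h2.congr_deriv ?_
      rw [div_eq_iff hne]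
      simp only [Pi.neg_apply, Pi.pow_apply]
      push_cast
      ring)).2
  refine (h.const_mul (1 / (2 * Real.pi : ℂ))).congr_deriv ?_
  congr 1
  rw [← integral_const_mul]
  congr 1
  funext σ
  rw [mul_assoc (-(2 * b * (r : ℂ))), ← Complex.exp_add]
  ring_nf

/-- The derivatives of the two sides agree for `r > 0`, by the Gaussian integral, and both sides
equal `1/2` at `r = 0`. -/
theorem gaussCauchy_eq_gaussPrimitive {c : ℂ} (hc : 0 < c.re) (hc2 : 0 < (c ^ 2).re) {r : ℝ}
    (hr : 0 ≤ r) : gaussCauchy (c ^ 2) r = 1 / 2 - gaussPrimitive (c * r) / √Real.pi := by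
  have hc0 : c ≠ 0 := by rintro rfl; simp at hc
  have hsq : (√Real.pi : ℂ) ≠ 0 := by
    exact_mod_cast (Real.sqrt_pos.2 Real.pi_pos).ne'
  have hsq2 : (√Real.pi : ℂ) ^ 2 = Real.pi := by
    exact_mod_cast Real.sq_sqrt Real.pi_pos.le
  have hpi : (Real.pi : ℂ) ≠ 0 := by exact_mod_cast Real.pi_ne_zero
  set D : ℝ → ℂ := fun s => gaussCauchy (c ^ 2) s + gaussPrimitive (c * s) / √Real.pi with hD
  have hd : ∀ s : ℝ, 0 < s → HasDerivAt D 0 s := fun s hs => by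
    have h1 : HasDerivAt (fun s : ℝ => c * (s : ℂ)) (c * 1) s :=
      (Complex.ofRealCLM.hasDerivAt (x := s)).const_mul c
    have h2 := ((hasDerivAt_gaussPrimitive (c * s)).comp s h1).div_const (√Real.pi : ℂ)
    refine ((hasDerivAt_gaussCauchy hc2 hs).add h2).congr_deriv ?_
    have hs0 : (s : ℂ) ≠ 0 := by exact_mod_cast hs.ne'
    have hbre : 0 < (c ^ 2 * (s : ℂ) ^ 2).re := by
      rw [← Complex.ofReal_pow, Complex.re_mul_ofReal]; positivity
    rw [integral_gaussian_complex hbre]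
    have hq : (Real.pi : ℂ) / (c ^ 2 * s ^ 2) = ((√Real.pi : ℂ) / (c * s)) ^ 2 := by
      rw [div_pow, hsq2, mul_pow]
    -- The positive real part decides which square root the principal power in the Gaussian integral
    -- returns.
    have hre : 0 < ((√Real.pi : ℂ) / (c * s)).re := by
      have : (√Real.pi : ℂ) / (c * s) = ((√Real.pi / s : ℝ) : ℂ) * c⁻¹ := by
        push_cast; field_simp
      rw [this, Complex.re_ofReal_mul, Complex.inv_re]
      have := Complex.normSq_pos.2 hc0
      positivity
    rw [hq, one_div (2 : ℂ), Complex.sq_cpow_two_inv hre]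
    have e : -(c * (s : ℂ)) ^ 2 = -(c ^ 2 * s ^ 2) := by ring
    rw [e]
    field_simp
    rw [hsq2]
    ring
  have hcont : Continuous D := by
    have hg : Continuous gaussPrimitive :=
      continuous_iff_continuousAt.2 fun z => (hasDerivAt_gaussPrimitive z).continuousAt
    exact (continuous_gaussCauchy hc2).add ((hg.comp (by fun_prop)).div_const _)
  -- The derivative formula is available only for positive arguments, so the right derivative at `0`
  -- comes from continuity and the limit of the derivatives.
  have h0 : HasDerivWithinAt D 0 (Ici 0) 0 := by
    refine hasDerivWithinAt_Ici_of_tendsto_deriv (s := Ioi 0)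
      (fun s hs => (hd s hs).differentiableAt.differentiableWithinAt)
      hcont.continuousAt.continuousWithinAt self_mem_nhdsWithin ?_
    refine tendsto_const_nhds.congr' ?_
    filter_upwards [self_mem_nhdsWithin] with s hs
    exact (hd s hs).deriv.symm
  have hconst := constant_of_has_deriv_right_zero (f := D) (a := 0) (b := r) hcont.continuousOn
    (fun s hs => by
      rcases hs.1.eq_or_lt with h | h
      · rw [← h]; exact h0
      · exact (hd s h).hasDerivWithinAt) r ⟨hr, le_rfl⟩
  have hD0 : D 0 = 1 / 2 := by
    have h1 : gaussCauchy (c ^ 2) 0 = 1 / 2 := by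
      have : ∀ σ : ℝ, (1 : ℂ) / (1 + (σ : ℂ) ^ 2) = (((1 + σ ^ 2)⁻¹ : ℝ) : ℂ) := fun σ => by
        push_cast; rw [one_div]
      simp only [gaussCauchy, Complex.ofReal_zero, ne_eq, OfNat.ofNat_ne_zero, not_false_eq_true,
        zero_pow, mul_zero, neg_zero, zero_mul, Complex.exp_zero, this]
      rw [integral_complex_ofReal, integral_univ_inv_one_add_sq]
      field_simp
    simp [hD, h1, gaussPrimitive_zero]
  rw [hD0] at hconst
  exact eq_sub_of_add_eq hconst

/-- For `r > 0`, `1/2 + gaussPrimitive (c r) / √π` is `1` minus the Cauchy integral, and the `1`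
produces the exponential; for `r < 0` oddness gives the Cauchy integral alone. Two terms
discontinuous at `r = 0` thus add up to an entire function. -/
theorem transition_mul_ofReal {c : ℂ} (hc : 0 < c.re) (hc2 : 0 < (c ^ 2).re) {r : ℝ}
    (hr : r ≠ 0) : transition (c * r) = SignType.sign r / (2 * Real.pi) *
      (∫ σ : ℝ, Complex.exp (-(c ^ 2 * r ^ 2) * (σ : ℂ) ^ 2) / (1 + (σ : ℂ) ^ 2)) -
        (if 0 < r then Complex.exp (c ^ 2 * r ^ 2) else 0) := by
  have hE : Complex.exp (c ^ 2 * (r : ℂ) ^ 2) * Complex.exp (-(c ^ 2 * r ^ 2)) = 1 := by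
    rw [← Complex.exp_add]; simp
  have hp : (c * (r : ℂ)) ^ 2 = c ^ 2 * r ^ 2 := by ring
  rcases hr.lt_or_gt with h | h
  · have h1 := gaussCauchy_eq_gaussPrimitive hc hc2 (r := -r) (by linarith)
    rw [gaussCauchy_eq] at h1
    push_cast at h1
    rw [mul_neg, gaussPrimitive_neg, neg_sq] at h1
    rw [transition, if_neg h.not_gt, sign_neg h, hp]
    rw [SignType.coe_neg_one]
    linear_combination (Complex.exp (c ^ 2 * (r : ℂ) ^ 2)) * h1 -
      (1 / (2 * Real.pi) * ∫ σ : ℝ, Complex.exp (-(c ^ 2 * r ^ 2) * (σ : ℂ) ^ 2) /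
        (1 + (σ : ℂ) ^ 2)) * hE
  · have h1 := gaussCauchy_eq_gaussPrimitive hc hc2 h.le
    rw [gaussCauchy_eq] at h1
    rw [transition, if_pos h, sign_pos h, hp]
    rw [SignType.coe_one]
    linear_combination (-Complex.exp (c ^ 2 * (r : ℂ) ^ 2)) * h1 +
      (1 / (2 * Real.pi) * ∫ σ : ℝ, Complex.exp (-(c ^ 2 * r ^ 2) * (σ : ℂ) ^ 2) /
        (1 + (σ : ℂ) ^ 2)) * hE

theorem norm_transition_le {c : ℂ} (hc : 0 < c.re) (hc2 : 0 < (c ^ 2).re) (r : ℝ) :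
    ‖transition (c * r)‖ ≤
      1 / 2 + (if 0 < r then Real.exp ((c ^ 2).re * r ^ 2) else 0) := by
  rcases eq_or_ne r 0 with rfl | hr
  · simp [transition_zero]
  rw [transition_mul_ofReal hc hc2 hr]
  refine (norm_sub_le _ _).trans (add_le_add ?_ (le_of_eq ?_))
  · rw [norm_mul, norm_div]
    have hb : 0 ≤ (c ^ 2 * (r : ℂ) ^ 2).re := by
      rw [← Complex.ofReal_pow, Complex.re_mul_ofReal]; positivity
    have h1 := norm_integral_cexp_neg_mul_sq_div_le hb
    have h3 : ‖(2 * Real.pi : ℂ)‖ = 2 * Real.pi := by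
      rw [norm_mul, Complex.norm_real, Real.norm_of_nonneg Real.pi_pos.le]; simp
    have h2 : ‖((SignType.sign r : SignType) : ℂ)‖ = 1 := by
      rcases hr.lt_or_gt with h | h
      · simp [sign_neg h]
      · simp [sign_pos h]
    rw [h2, h3]
    calc 1 / (2 * Real.pi) * _ ≤ 1 / (2 * Real.pi) * Real.pi := by gcongr
      _ = 1 / 2 := by field_simp
  · split_ifs
    · rw [Complex.norm_exp, ← Complex.ofReal_pow, Complex.re_mul_ofReal]
    · simp

section SlitPlane

open scoped ContDiff

/-! ### Geometry of the slit plane -/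

/-- The point `x₁ + i x₂`. -/
def toComplex : Plane →L[ℝ] ℂ :=
  Complex.ofRealCLM.comp (EuclideanSpace.proj 0) +
    Complex.I • Complex.ofRealCLM.comp (EuclideanSpace.proj 1)

theorem toComplex_apply (x : Plane) : toComplex x = ⟨x 0, x 1⟩ := by
  apply Complex.ext <;> simp [toComplex]

theorem norm_toComplex (x : Plane) : ‖toComplex x‖ = ‖x‖ := by
  rw [toComplex_apply, EuclideanSpace.norm_eq, Complex.norm_eq_sqrt_sq_add_sq]
  simp

theorem mem_Q_iff (x : Plane) : x ∈ Q ↔ -toComplex x ∈ Complex.slitPlane := by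
  rw [Complex.mem_slitPlane_iff, toComplex_apply]
  simp only [Q, screen, mem_compl_iff, mem_ofPred_eq, not_and_or, not_le, Complex.neg_re,
    Complex.neg_im, neg_pos, ne_eq, neg_eq_zero]

theorem isOpen_Q : IsOpen Q := by
  have : Q = (fun x => -toComplex x) ⁻¹' Complex.slitPlane := by
    ext x; exact mem_Q_iff x
  rw [this]
  exact Complex.isOpen_slitPlane.preimage (by fun_prop)

theorem norm_pos_of_mem_Q {x : Plane} (hx : x ∈ Q) : 0 < ‖x‖ := by
  rw [← norm_toComplex, norm_pos_iff]
  intro h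
  have := (mem_Q_iff x).1 hx
  simp [h] at this

theorem toComplex_eq_polar (x : Plane) :
    toComplex x = ‖x‖ * Complex.exp (Complex.I * polarAngle x) := by
  rw [← norm_toComplex, toComplex_apply, polarAngle]
  have h := Complex.norm_mul_exp_arg_mul_I ⟨x 0, x 1⟩
  split_ifs
  · rw [mul_comm Complex.I, h]
  · have e : Complex.I * ((Complex.arg ⟨x 0, x 1⟩ + 2 * Real.pi : ℝ) : ℂ) =
        Complex.arg ⟨x 0, x 1⟩ * Complex.I + 2 * Real.pi * Complex.I := by
      push_cast; ring
    rw [e, Complex.exp_add, Complex.exp_two_pi_mul_I, mul_one, h]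

theorem polarAngle_mem_Ioo {x : Plane} (hx : x ∈ Q) : polarAngle x ∈ Ioo 0 (2 * Real.pi) := by
  have h1 := Complex.neg_pi_lt_arg ⟨x 0, x 1⟩
  have h2 := Complex.arg_le_pi ⟨x 0, x 1⟩
  have h3 : Complex.arg ⟨x 0, x 1⟩ ≠ 0 := by
    intro h
    rw [Complex.arg_eq_zero_iff] at h
    exact hx h
  have hpi := Real.pi_pos
  unfold polarAngle
  split_ifs with h
  · exact ⟨lt_of_le_of_ne h h3.symm, by linarith⟩
  · push Not at h
    exact ⟨by linarith, by linarith⟩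

theorem coord_zero_eq (x : Plane) : x 0 = ‖x‖ * Real.cos (polarAngle x) := by
  have h := congrArg Complex.re (toComplex_eq_polar x)
  rw [toComplex_apply, Complex.re_ofReal_mul, mul_comm Complex.I, Complex.exp_ofReal_mul_I_re] at h
  exact h

theorem coord_one_eq (x : Plane) : x 1 = ‖x‖ * Real.sin (polarAngle x) := by
  have h := congrArg Complex.im (toComplex_eq_polar x)
  rw [toComplex_apply, Complex.im_ofReal_mul, mul_comm Complex.I, Complex.exp_ofReal_mul_I_im] at h
  exact h

theorem measurable_polarAngle : Measurable polarAngle := by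
  have h : Measurable fun x : Plane => Complex.arg ⟨x 0, x 1⟩ := by
    simp_rw [← toComplex_apply]
    exact Complex.measurable_arg.comp toComplex.measurable
  exact Measurable.ite (measurableSet_le measurable_const h) h (h.add_const _)

theorem incidentPhase_eq (α : ℝ) (x : Plane) :
    incidentPhase α x = ‖x‖ * Real.cos (polarAngle x - phiPlus α) := by
  rw [incidentPhase, phiPlus, coord_zero_eq, coord_one_eq, Real.cos_sub]
  ring

theorem reflectedPhase_eq (α : ℝ) (x : Plane) :
    reflectedPhase α x = ‖x‖ * Real.cos (polarAngle x - phiMinus α) := by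
  rw [reflectedPhase, phiMinus, coord_zero_eq, coord_one_eq, Real.cos_sub, Real.cos_pi_sub,
    Real.sin_pi_sub, add_comm Real.pi α, Real.cos_add_pi, Real.sin_add_pi]
  ring

/-- The holomorphic square root of `x₁ + i x₂` on the slit plane. -/
def slitSqrt (x : Plane) : ℂ := Complex.I * (-toComplex x) ^ (2⁻¹ : ℂ)

theorem slitSqrt_eq {x : Plane} (hx : x ∈ Q) :
    slitSqrt x = √‖x‖ * Complex.exp (Complex.I * (polarAngle x / 2 : ℝ)) := by
  obtain ⟨h0, h1⟩ := polarAngle_mem_Ioo hx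
  have hI : Complex.I = Complex.exp (Complex.I * (Real.pi / 2 : ℝ)) := by
    rw [mul_comm]; push_cast; exact Complex.exp_pi_div_two_mul_I.symm
  -- The argument of `-(x₁ + i x₂)` is `φ - π ∈ (-π, π)`; its half has positive cosine, so `w` is
  -- the principal root.
  set w : ℂ := √‖x‖ * Complex.exp (((polarAngle x - Real.pi) / 2 : ℝ) * Complex.I) with hw
  have hsq : (√‖x‖ : ℂ) ^ 2 = ‖x‖ := by exact_mod_cast Real.sq_sqrt (norm_nonneg x)
  have h2 : -toComplex x = w ^ 2 := by
    rw [toComplex_eq_polar, hw, mul_pow, hsq, ← Complex.exp_nat_mul]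
    have : (2 : ℕ) * ((((polarAngle x - Real.pi) / 2 : ℝ) : ℂ) * Complex.I) =
        Complex.I * polarAngle x - Real.pi * Complex.I := by push_cast; ring
    rw [this, Complex.exp_sub, Complex.exp_pi_mul_I]
    ring
  have hre : 0 < w.re := by
    rw [hw, Complex.re_ofReal_mul, Complex.exp_ofReal_mul_I_re]
    exact mul_pos (Real.sqrt_pos.2 (norm_pos_of_mem_Q hx))
      (Real.cos_pos_of_mem_Ioo ⟨by linarith, by linarith⟩)
  rw [slitSqrt, h2, Complex.sq_cpow_two_inv hre, hw]
  nth_rewrite 1 [hI]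
  rw [mul_left_comm, ← Complex.exp_add]
  congr 2
  push_cast
  ring

/-- The coordinate `√ρ sin ((φ - θ) / 2)`, which vanishes on the ray `φ = θ`. -/
def edgeCoord (θ : ℝ) (x : Plane) : ℝ :=
  (Complex.exp (-(θ / 2 : ℝ) * Complex.I) * slitSqrt x).im

theorem edgeCoord_eq (θ : ℝ) {x : Plane} (hx : x ∈ Q) :
    edgeCoord θ x = √‖x‖ * Real.sin ((polarAngle x - θ) / 2) := by
  rw [edgeCoord, slitSqrt_eq hx, mul_left_comm, ← Complex.exp_add]
  have : -((θ / 2 : ℝ) : ℂ) * Complex.I + Complex.I * ((polarAngle x / 2 : ℝ) : ℂ) =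
      ((polarAngle x - θ) / 2 : ℝ) * Complex.I := by push_cast; ring
  rw [this, Complex.im_ofReal_mul, Complex.exp_ofReal_mul_I_im]

/-- The half-angle formula expresses the phase of a plane wave through the edge coordinate. -/
theorem norm_sub_two_mul_edgeCoord_sq (θ : ℝ) {x : Plane} (hx : x ∈ Q) :
    ‖x‖ - 2 * edgeCoord θ x ^ 2 = ‖x‖ * Real.cos (polarAngle x - θ) := by
  have h : Real.cos (polarAngle x - θ) = 1 - 2 * Real.sin ((polarAngle x - θ) / 2) ^ 2 := by
    rw [show polarAngle x - θ = 2 * ((polarAngle x - θ) / 2) by ring, Real.cos_two_mul,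
      Real.cos_sq']
    ring_nf
  rw [edgeCoord_eq θ hx, mul_pow, Real.sq_sqrt (norm_nonneg x), h]
  ring

theorem edgeCoord_pos_iff {θ : ℝ} (hθ : θ ∈ Ioo 0 (2 * Real.pi)) {x : Plane} (hx : x ∈ Q) :
    0 < edgeCoord θ x ↔ θ < polarAngle x := by
  obtain ⟨h0, h1⟩ := polarAngle_mem_Ioo hx
  rw [edgeCoord_eq θ hx, mul_pos_iff_of_pos_left (Real.sqrt_pos.2 (norm_pos_of_mem_Q hx))]
  constructor
  · intro h
    by_contra! hle
    exact h.not_ge (Real.sin_nonpos_of_nonpos_of_neg_pi_le (by linarith) (by linarith [hθ.2]))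
  · intro h
    exact Real.sin_pos_of_pos_of_lt_pi (by linarith) (by linarith [hθ.1])

theorem edgeCoord_neg_iff {θ : ℝ} (hθ : θ ∈ Ioo 0 (2 * Real.pi)) {x : Plane} (hx : x ∈ Q) :
    edgeCoord θ x < 0 ↔ polarAngle x < θ := by
  obtain ⟨h0, h1⟩ := polarAngle_mem_Ioo hx
  have hp := Real.sqrt_pos.2 (norm_pos_of_mem_Q hx)
  rw [edgeCoord_eq θ hx, show √‖x‖ * Real.sin ((polarAngle x - θ) / 2) < 0 ↔
    Real.sin ((polarAngle x - θ) / 2) < 0 from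
      ⟨fun h => by by_contra! h'; exact h.not_ge (mul_nonneg hp.le h'),
        mul_neg_of_pos_of_neg hp⟩]
  constructor
  · intro h
    by_contra! hle
    exact h.not_ge (Real.sin_nonneg_of_nonneg_of_le_pi (by linarith) (by linarith [hθ.1]))
  · intro h
    exact Real.sin_neg_of_neg_of_neg_pi_lt (by linarith) (by linarith [hθ.2])

/-- The complex derivative of the root has modulus `1 / (2√ρ)`; the factor `1/2` is given away. -/
theorem hasFDerivAt_slitSqrt {x : Plane} (hx : x ∈ Q) :
    ∃ L : Plane →L[ℝ] ℂ, HasFDerivAt slitSqrt L x ∧ ‖L‖ ≤ (√‖x‖)⁻¹ := by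
  have hs := (mem_Q_iff x).1 hx
  have h1 : HasFDerivAt (fun x => -toComplex x) (-toComplex) x := toComplex.hasFDerivAt.neg
  have h2 : HasDerivAt (fun z : ℂ => Complex.I * z ^ (2⁻¹ : ℂ))
      (Complex.I * (2⁻¹ * (-toComplex x) ^ ((2⁻¹ : ℂ) - 1))) (-toComplex x) := by
    have := ((hasDerivAt_id (-toComplex x)).cpow_const (c := (2⁻¹ : ℂ)) hs).const_mul Complex.I
    simpa using this
  have h3 := (h2.hasFDerivAt.restrictScalars ℝ).comp x h1
  refine ⟨_, h3, ContinuousLinearMap.opNorm_le_bound _ (by positivity) fun v => ?_⟩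
  have hne : -toComplex x ≠ 0 := Complex.slitPlane_ne_zero hs
  have hn : ‖(-toComplex x) ^ ((2⁻¹ : ℂ) - 1)‖ = (√‖x‖)⁻¹ := by
    have : ((2⁻¹ : ℂ) - 1) = ((-(1 / 2) : ℝ) : ℂ) := by push_cast; norm_num
    rw [this, Complex.norm_cpow_real, norm_neg, norm_toComplex, Real.rpow_neg (norm_nonneg x),
      Real.sqrt_eq_rpow]
  have hv : ‖(-toComplex) v‖ = ‖v‖ := by simp [norm_toComplex]
  have hsp : 0 ≤ (√‖x‖)⁻¹ * ‖v‖ := by positivity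
  simp only [ContinuousLinearMap.comp_apply, ContinuousLinearMap.coe_restrictScalars',
    ContinuousLinearMap.toSpanSingleton_apply, smul_eq_mul]
  rw [norm_mul, hv, norm_mul, norm_mul, hn, Complex.norm_I]
  norm_num
  nlinarith

theorem contDiffAt_slitSqrt {x : Plane} (hx : x ∈ Q) : ContDiffAt ℝ ω slitSqrt x := by
  have hs := (mem_Q_iff x).1 hx
  have h : AnalyticAt ℂ (fun z : ℂ => z ^ (2⁻¹ : ℂ)) (-toComplex x) :=
    analyticAt_id.cpow analyticAt_const hs
  have h' : ContDiffAt ℝ ω (fun z : ℂ => z ^ (2⁻¹ : ℂ)) (-toComplex x) :=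
    (h.restrictScalars (𝕜 := ℝ)).contDiffAt
  exact contDiffAt_const.mul (h'.comp x (f := fun x => -toComplex x) toComplex.contDiff.neg.contDiffAt)

theorem hasFDerivAt_edgeCoord (θ : ℝ) {x : Plane} (hx : x ∈ Q) :
    ∃ L : Plane →L[ℝ] ℝ, HasFDerivAt (edgeCoord θ) L x ∧ ‖L‖ ≤ (√‖x‖)⁻¹ := by
  obtain ⟨L, hL, hLn⟩ := hasFDerivAt_slitSqrt hx
  have h := Complex.imCLM.hasFDerivAt.comp x
    (hL.const_mul (Complex.exp (-(θ / 2 : ℝ) * Complex.I)))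
  refine ⟨_, h, ContinuousLinearMap.opNorm_le_bound _ (by positivity) fun v => ?_⟩
  simp only [ContinuousLinearMap.comp_apply, Complex.imCLM_apply, smul_apply,
    smul_eq_mul]
  refine (Complex.abs_im_le_norm _).trans ?_
  rw [norm_mul]
  have : ‖Complex.exp (-((θ / 2 : ℝ) : ℂ) * Complex.I)‖ = 1 := by
    rw [← Complex.ofReal_neg]; exact Complex.norm_exp_ofReal_mul_I _
  rw [this, one_mul]
  exact L.le_of_opNorm_le hLn v

theorem contDiffAt_edgeCoord (θ : ℝ) {x : Plane} (hx : x ∈ Q) : ContDiffAt ℝ ω (edgeCoord θ) x :=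
  Complex.imCLM.contDiff.contDiffAt.comp x (contDiffAt_const.mul (contDiffAt_slitSqrt hx))

theorem volume_line_eq_zero {a b : ℝ} (h : a ≠ 0 ∨ b ≠ 0) :
    volume {x : Plane | a * x 0 + b * x 1 = 0} = 0 := by
  let L : Plane →ₗ[ℝ] ℝ := ((a • Complex.reCLM + b • Complex.imCLM).comp toComplex).toLinearMap
  have hL : ∀ x, L x = a * x 0 + b * x 1 := fun x => by simp [L, toComplex_apply]
  have : {x : Plane | a * x 0 + b * x 1 = 0} = (LinearMap.ker L : Set Plane) := by
    ext x; simp [← hL]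
  rw [this]
  refine Measure.addHaar_submodule _ _ fun htop => ?_
  have hz : ∀ x, L x = 0 := fun x => LinearMap.mem_ker.1 (htop ▸ Submodule.mem_top)
  rcases h with h | h
  · have := hz (EuclideanSpace.single 0 1)
    rw [hL] at this
    simp at this
    exact h this
  · have := hz (EuclideanSpace.single 1 1)
    rw [hL] at this
    simp at this
    exact h this

theorem ae_mem_Q : ∀ᵐ x : Plane, x ∈ Q := by
  have h := volume_line_eq_zero (a := 0) (b := 1) (Or.inr one_ne_zero)
  refine measure_mono_null (fun x hx => ?_) h
  have : x ∈ screen := by simpa [Q] using hx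
  simpa using this.2

theorem ae_polarAngle_ne (θ : ℝ) : ∀ᵐ x : Plane, polarAngle x ≠ θ := by
  have h := volume_line_eq_zero (a := Real.sin θ) (b := -Real.cos θ) (by
    by_contra! hh
    have := Real.sin_sq_add_cos_sq θ
    rw [hh.1, neg_eq_zero.1 hh.2] at this
    norm_num at this)
  refine measure_mono_null (fun x hx => ?_) h
  have hx' : polarAngle x = θ := by simpa using hx
  rw [mem_ofPred_eq, coord_zero_eq, coord_one_eq, hx']
  ring

theorem restrict_Q : (volume : Measure Plane).restrict Q = volume :=
  Measure.restrict_eq_self_of_ae_mem ae_mem_Q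

end SlitPlane

/-! ### The diffracted wave as a superposition of Cauchy kernels -/

/-- Shifting by `iπ/2` turns `coth` into `tanh`, and `cosh² - sinh² = 1`. At the poles both sides
are `0`, since division by zero gives `0`. -/
theorem coth_sub_coth_sub_pi_div_two (w : ℂ) :
    coth w - coth (w - Complex.I * Real.pi / 2) = 2 / Complex.sinh (2 * w) := by
  have hs : Complex.sinh (w - Complex.I * Real.pi / 2) = -Complex.I * Complex.cosh w := by
    rw [Complex.sinh_sub, mul_div_assoc, mul_comm Complex.I, Complex.sinh_mul_I,
      Complex.cosh_mul_I, Complex.cos_pi_div_two, Complex.sin_pi_div_two]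
    ring
  have hc : Complex.cosh (w - Complex.I * Real.pi / 2) = -Complex.I * Complex.sinh w := by
    rw [Complex.cosh_sub, mul_div_assoc, mul_comm Complex.I, Complex.sinh_mul_I,
      Complex.cosh_mul_I, Complex.cos_pi_div_two, Complex.sin_pi_div_two]
    ring
  have hI : (-Complex.I) ≠ 0 := neg_ne_zero.2 Complex.I_ne_zero
  rw [coth, coth, hs, hc, mul_div_mul_left _ _ hI, Complex.sinh_two_mul]
  rcases eq_or_ne (Complex.sinh w) 0 with h1 | h1
  · simp [h1]
  rcases eq_or_ne (Complex.cosh w) 0 with h2 | h2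
  · simp [h2]
  have h3 := Complex.cosh_sq w
  field_simp
  linear_combination h3

/-- The four terms of `kernelZ` pair up by the sign of `α`; within a pair the arguments differ by
`2πi / 4 = iπ/2`. -/
theorem kernelZ_eq (α φ β : ℝ) :
    kernelZ α (β + 2 * Real.pi * Complex.I - Complex.I * φ) =
      2 / Complex.sinh ((β - Complex.I * (φ - phiMinus α : ℝ)) / 2) -
        2 / Complex.sinh ((β - Complex.I * (φ - phiPlus α : ℝ)) / 2) := by
  have h1 := coth_sub_coth_sub_pi_div_two ((β - Complex.I * (φ - phiMinus α : ℝ)) / 4)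
  have h2 := coth_sub_coth_sub_pi_div_two ((β - Complex.I * (φ - phiPlus α : ℝ)) / 4)
  rw [show 2 * (((β : ℂ) - Complex.I * (φ - phiMinus α : ℝ)) / 4) =
    (β - Complex.I * (φ - phiMinus α : ℝ)) / 2 by ring] at h1
  rw [show 2 * (((β : ℂ) - Complex.I * (φ - phiPlus α : ℝ)) / 4) =
    (β - Complex.I * (φ - phiPlus α : ℝ)) / 2 by ring] at h2
  rw [← h1, ← h2, kernelZ, kernelU, kernelU]
  simp only [phiPlus, phiMinus]
  push_cast
  ring_nf

theorem sinh_half_sub_eq (β θ : ℝ) : Complex.sinh ((β - Complex.I * θ) / 2) =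
    ((Real.sinh (β / 2) * Real.cos (θ / 2) : ℝ) : ℂ) -
      Complex.I * (Real.cosh (β / 2) * Real.sin (θ / 2) : ℝ) := by
  rw [sub_div, Complex.sinh_sub, mul_comm Complex.I, mul_div_right_comm, Complex.sinh_mul_I,
    Complex.cosh_mul_I]
  push_cast
  ring

theorem sinh_sq_add_sin_sq (β θ : ℝ) :
    (Real.sinh (β / 2) * Real.cos (θ / 2)) ^ 2 + (Real.cosh (β / 2) * Real.sin (θ / 2)) ^ 2 =
      Real.sinh (β / 2) ^ 2 + Real.sin (θ / 2) ^ 2 := by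
  have h1 := Real.cosh_sq (β / 2)
  have h2 := Real.sin_sq_add_cos_sq (θ / 2)
  linear_combination Real.sin (θ / 2) ^ 2 * h1 + Real.sinh (β / 2) ^ 2 * h2

/-- The squared modulus is `sinh² (β/2) + sin² (θ/2)`. Away from the critical ray the kernel is
therefore bounded. -/
theorem abs_sin_le_norm_sinh (β θ : ℝ) :
    |Real.sin (θ / 2)| ≤ ‖Complex.sinh ((β - Complex.I * θ) / 2)‖ := by
  refine abs_le_of_sq_le_sq ?_ (norm_nonneg _)
  rw [sinh_half_sub_eq, Complex.sq_norm, Complex.normSq_apply]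
  simp only [Complex.sub_re, Complex.sub_im, Complex.ofReal_re, Complex.ofReal_im,
    Complex.re_mul_ofReal, Complex.im_mul_ofReal, Complex.I_re, Complex.I_im]
  have := sinh_sq_add_sin_sq β θ
  nlinarith [sq_nonneg (Real.sinh (β / 2))]

/-- Twice the even part of the kernel, the only part that survives against a function of `cosh β`.
-/
theorem inv_sinh_add_inv_sinh_neg (β : ℝ) {θ : ℝ} (hθ : Real.sin (θ / 2) ≠ 0) :
    1 / Complex.sinh ((β - Complex.I * θ) / 2) +
      1 / Complex.sinh (((-β : ℝ) - Complex.I * θ) / 2) =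
    2 * Complex.I * ((Real.sin (θ / 2) * Real.cosh (β / 2) /
      (Real.sinh (β / 2) ^ 2 + Real.sin (θ / 2) ^ 2) : ℝ) : ℂ) := by
  have hp : 0 < |Real.sin (θ / 2)| := abs_pos.2 hθ
  have hA : Complex.sinh ((β - Complex.I * θ) / 2) ≠ 0 :=
    norm_pos_iff.1 (hp.trans_le (abs_sin_le_norm_sinh β θ))
  have hB : Complex.sinh (((-β : ℝ) - Complex.I * θ) / 2) ≠ 0 :=
    norm_pos_iff.1 (hp.trans_le (abs_sin_le_norm_sinh (-β) θ))
  have hD : (Real.sinh (β / 2) ^ 2 + Real.sin (θ / 2) ^ 2 : ℂ) ≠ 0 := by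
    have : 0 < Real.sinh (β / 2) ^ 2 + Real.sin (θ / 2) ^ 2 := by positivity
    exact_mod_cast this.ne'
  have h0 := congrArg (fun x : ℝ => (x : ℂ)) (sinh_sq_add_sin_sq β θ)
  rw [div_add_div _ _ hA hB, sinh_half_sub_eq, sinh_half_sub_eq, neg_div, Real.sinh_neg,
    Real.cosh_neg]
  rw [sinh_half_sub_eq] at hA
  rw [sinh_half_sub_eq, neg_div, Real.sinh_neg, Real.cosh_neg] at hB
  push_cast at *
  rw [mul_div_assoc', div_eq_div_iff (mul_ne_zero hA hB) hD]
  generalize Complex.sinh (β / 2) = S at *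
  generalize Complex.cosh (β / 2) = C at *
  generalize Complex.sin (θ / 2) = s at *
  generalize Complex.cos (θ / 2) = c at *
  linear_combination (2 * Complex.I * s * C) * h0 - (2 * Complex.I * s ^ 3 * C ^ 3) * Complex.I_sq

theorem integral_sinh_substitution (h : ℝ → ℂ) {s : ℝ} (hs : 0 < s) :
    ∫ σ, h σ = ∫ β : ℝ, (Real.cosh (β / 2) / (2 * s)) • h (Real.sinh (β / 2) / s) := by
  have hd : ∀ β : ℝ, HasDerivAt (fun β : ℝ => Real.sinh (β / 2) / s)
      (Real.cosh (β / 2) / (2 * s)) β := fun β => by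
    refine ((((hasDerivAt_id β).div_const 2).sinh).div_const s).congr_deriv ?_
    simp only [id]
    field_simp
  have hinj : Function.Injective fun β : ℝ => Real.sinh (β / 2) / s := fun a b hab => by
    have h1 : Real.sinh (a / 2) = Real.sinh (b / 2) := by
      simpa [div_left_inj' hs.ne'] using hab
    have h2 := Real.sinh_injective h1
    linarith
  have hsurj : Function.Surjective fun β : ℝ => Real.sinh (β / 2) / s := fun σ => by
    obtain ⟨y, hy⟩ := Real.sinh_surjective (σ * s)
    refine ⟨2 * y, ?_⟩
    simp only
    rw [mul_div_cancel_left₀ y two_ne_zero, hy, mul_div_cancel_right₀ _ hs.ne']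
  have := integral_image_eq_integral_abs_deriv_smul MeasurableSet.univ
    (fun β _ => (hd β).hasDerivWithinAt) hinj.injOn h
  rw [image_univ, hsurj.range_eq, setIntegral_univ, setIntegral_univ] at this
  rw [this]
  congr 1
  funext β
  rw [abs_of_pos (by have := Real.cosh_pos (β / 2); positivity)]

/-- After symmetrization, substitute `σ = sinh (β/2) / |s|`; then `cosh β = 1 + 2 sinh² (β/2) = 1 +
2s²σ²`, and the sign of `s` remains because the substitution uses `|s|`. -/
theorem integral_div_sinh_eq (G : ℝ → ℂ) {θ : ℝ} (hθ : Real.sin (θ / 2) ≠ 0)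
    (hint : Integrable fun β : ℝ =>
      1 / Complex.sinh ((β - Complex.I * θ) / 2) * G (Real.cosh β)) :
    ∫ β : ℝ, 1 / Complex.sinh ((β - Complex.I * θ) / 2) * G (Real.cosh β) =
      2 * Complex.I * SignType.sign (Real.sin (θ / 2)) *
        ∫ σ : ℝ, G (1 + 2 * Real.sin (θ / 2) ^ 2 * σ ^ 2) / (1 + (σ : ℂ) ^ 2) := by
  set s := Real.sin (θ / 2) with hs
  have hneg := integral_neg_eq_self
    (fun β : ℝ => 1 / Complex.sinh ((β - Complex.I * θ) / 2) * G (Real.cosh β)) volume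
  have hint' := hint.comp_neg
  have h2 : ∫ β : ℝ, 1 / Complex.sinh ((β - Complex.I * θ) / 2) * G (Real.cosh β) =
      ∫ β : ℝ, Complex.I * ((s * Real.cosh (β / 2) / (Real.sinh (β / 2) ^ 2 + s ^ 2) : ℝ) : ℂ) *
        G (Real.cosh β) := by
    have h3 := integral_add hint hint'
    rw [hneg, ← two_mul] at h3
    rw [← mul_right_inj' (two_ne_zero' ℂ), ← h3, ← integral_const_mul]
    congr 1
    funext β
    rw [Real.cosh_neg, ← add_mul, inv_sinh_add_inv_sinh_neg β hθ]
    ring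
  rw [h2, integral_sinh_substitution
    (fun σ => G (1 + 2 * s ^ 2 * σ ^ 2) / (1 + (σ : ℂ) ^ 2)) (abs_pos.2 hθ), ← integral_const_mul]
  congr 1
  funext β
  have hcosh : Real.cosh β = 1 + 2 * s ^ 2 * (Real.sinh (β / 2) / |s|) ^ 2 := by
    rw [div_pow, sq_abs]
    have h4 : Real.cosh β = 2 * Real.sinh (β / 2) ^ 2 + 1 := by
      have h5 := Real.cosh_two_mul (β / 2)
      have h6 := Real.cosh_sq (β / 2)
      rw [mul_div_cancel₀ β two_ne_zero] at h5
      linarith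
    rw [h4]
    field_simp
    ring
  rw [← hcosh, Complex.real_smul]
  have hS : 0 < Real.sinh (β / 2) ^ 2 + s ^ 2 := by positivity
  have key : s * Real.cosh (β / 2) / (Real.sinh (β / 2) ^ 2 + s ^ 2) =
      2 * (SignType.sign s : ℝ) * (Real.cosh (β / 2) / (2 * |s|)) /
        (1 + (Real.sinh (β / 2) / |s|) ^ 2) := by
    have h7 : (SignType.sign s : ℝ) * |s| = s := sign_mul_abs s
    have h8 : 0 < |s| := abs_pos.2 hθ
    have h9 : (SignType.sign s : ℝ) = s / |s| := by rw [eq_div_iff h8.ne', h7]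
    rw [h9, div_pow, sq_abs]
    field_simp
    rw [sq_abs]
    ring
  rw [key]
  have hsg : ((SignType.sign s : ℝ) : ℂ) = (SignType.sign s : ℂ) := by
    rcases SignType.trichotomy (SignType.sign s) with h | h | h <;> simp [h]
  push_cast
  rw [hsg]
  ring

/-! ### Causal signals and the decomposition into edge waves. -/

/-- Measurable causal signals of polynomial growth. -/
structure IsTame (F : ℝ → ℂ) : Prop where
  measurable : Measurable F
  eq_zero_of_neg : ∀ s < 0, F s = 0
  growth : ∃ C : ℝ, 0 ≤ C ∧ ∃ N : ℕ, ∀ s, ‖F s‖ ≤ C * (1 + |s|) ^ N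

theorem IsTame.norm_le {F : ℝ → ℂ} (hF : IsTame F) :
    ∃ C : ℝ, 0 ≤ C ∧ ∃ N : ℕ, ∀ s t, s ≤ t → ‖F s‖ ≤ C * (1 + |t|) ^ N := by
  obtain ⟨C, hC, N, h⟩ := hF.growth
  refine ⟨C, hC, N, fun s t hst => ?_⟩
  rcases lt_or_ge s 0 with h0 | h0
  · rw [hF.eq_zero_of_neg s h0, norm_zero]; positivity
  · refine (h s).trans ?_
    have : |s| ≤ |t| := abs_le_abs_of_nonneg h0 hst
    gcongr

theorem IsTame.integrable_comp_cosh {F : ℝ → ℂ} (hF : IsTame F) {ρ : ℝ} (hρ : 0 < ρ) (t : ℝ) :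
    Integrable fun β : ℝ => F (t - ρ * Real.cosh β) := by
  obtain ⟨C, hC, N, h⟩ := hF.norm_le
  have hm : Measurable fun β : ℝ => F (t - ρ * Real.cosh β) :=
    hF.measurable.comp (by fun_prop)
  -- By causality the integrand vanishes unless `ρ cosh β ≤ t`, and `|β| ≤ 2 cosh β` confines `β` to
  -- this interval.
  have hi : Integrable (indicator (Icc (-(2 * t / ρ)) (2 * t / ρ))
      (fun _ : ℝ => C * (1 + |t|) ^ N)) :=
    (integrable_indicator_iff measurableSet_Icc).2 (integrableOn_const (by simp))
  refine hi.mono' hm.aestronglyMeasurable (Eventually.of_forall fun β => ?_)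
  by_cases hβ : β ∈ Icc (-(2 * t / ρ)) (2 * t / ρ)
  · rw [indicator_of_mem hβ]
    exact h _ _ (by have := Real.cosh_pos β; nlinarith)
  · rw [indicator_of_notMem hβ, hF.eq_zero_of_neg, norm_zero]
    rw [mem_Icc, ← abs_le, not_le] at hβ
    have h1 : |β| ≤ 2 * Real.cosh β := by
      rw [← Real.cosh_abs, Real.cosh_eq]
      have := Real.add_one_le_exp |β|
      have := Real.exp_pos (-|β|)
      linarith
    have h2 : 2 * t < |β| * ρ := (div_lt_iff₀ hρ).1 hβ
    nlinarith

theorem IsTame.integrable_div_sinh {F : ℝ → ℂ} (hF : IsTame F) {ρ : ℝ} (hρ : 0 < ρ) (t : ℝ)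
    {θ : ℝ} (hθ : Real.sin (θ / 2) ≠ 0) : Integrable fun β : ℝ =>
      1 / Complex.sinh ((β - Complex.I * θ) / 2) * F (t - ρ * Real.cosh β) := by
  refine (hF.integrable_comp_cosh hρ t).bdd_mul (c := |Real.sin (θ / 2)|⁻¹) ?_
    (Eventually.of_forall fun β => ?_)
  · apply Measurable.aestronglyMeasurable
    fun_prop
  · rw [norm_div, norm_one, one_div]
    exact inv_anti₀ (abs_pos.2 hθ) (abs_sin_le_norm_sinh β θ)

/-- The wave generated by the signal `F` at the signed edge coordinate `r` and the retarded
time `τ`. -/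
def edgeWave (F : ℝ → ℂ) (r τ : ℝ) : ℂ :=
  SignType.sign r / (2 * Real.pi) * (∫ σ : ℝ, F (τ - 2 * r ^ 2 * σ ^ 2) / (1 + (σ : ℂ) ^ 2)) -
    if 0 < r then F (τ + 2 * r ^ 2) else 0

theorem phiPlus_mem_Ioo {α : ℝ} (hα : Real.pi / 2 < α) (hα' : α < Real.pi) :
    phiPlus α ∈ Ioo 0 (2 * Real.pi) := by
  have := Real.pi_pos
  constructor <;> unfold phiPlus <;> linarith

theorem phiMinus_mem_Ioo {α : ℝ} (hα : Real.pi / 2 < α) (hα' : α < Real.pi) :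
    phiMinus α ∈ Ioo 0 (2 * Real.pi) := by
  have := Real.pi_pos
  constructor <;> unfold phiMinus <;> linarith

theorem edgeCoord_ne_zero {θ : ℝ} (hθ : θ ∈ Ioo 0 (2 * Real.pi)) {x : Plane} (hx : x ∈ Q)
    (h : polarAngle x ≠ θ) : edgeCoord θ x ≠ 0 := by
  rcases h.lt_or_gt with h | h
  · exact ((edgeCoord_neg_iff hθ hx).2 h).ne
  · exact ((edgeCoord_pos_iff hθ hx).2 h).ne'

theorem integral_div_sinh_eq_edge {F : ℝ → ℂ} (hF : IsTame F) {θ : ℝ}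
    (hθ : θ ∈ Ioo 0 (2 * Real.pi)) {x : Plane} (hx : x ∈ Q) (h : polarAngle x ≠ θ) (t : ℝ) :
    Integrable (fun β : ℝ => 1 / Complex.sinh ((β - Complex.I * (polarAngle x - θ : ℝ)) / 2) *
      F (t - ‖x‖ * Real.cosh β)) ∧
    ∫ β : ℝ, 1 / Complex.sinh ((β - Complex.I * (polarAngle x - θ : ℝ)) / 2) *
      F (t - ‖x‖ * Real.cosh β) = 2 * Complex.I * SignType.sign (edgeCoord θ x) *
        ∫ σ : ℝ, F (t - ‖x‖ - 2 * edgeCoord θ x ^ 2 * σ ^ 2) / (1 + (σ : ℂ) ^ 2) := by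
  have hρ := norm_pos_of_mem_Q hx
  have hsp := Real.sqrt_pos.2 hρ
  have he := edgeCoord_ne_zero hθ hx h
  have hs : Real.sin ((polarAngle x - θ) / 2) ≠ 0 := by
    intro h0
    rw [edgeCoord_eq θ hx, h0, mul_zero] at he
    exact he rfl
  have hi := hF.integrable_div_sinh hρ t hs
  refine ⟨hi, ?_⟩
  rw [integral_div_sinh_eq (fun y => F (t - ‖x‖ * y)) hs hi]
  have hsign : SignType.sign (edgeCoord θ x) =
      SignType.sign (Real.sin ((polarAngle x - θ) / 2)) := by
    rw [edgeCoord_eq θ hx, sign_mul, sign_pos hsp, one_mul]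
  rw [hsign]
  congr 2
  funext σ
  rw [edgeCoord_eq θ hx, mul_pow, Real.sq_sqrt hρ.le]
  ring_nf

/-- Subtracting the incident wave leaves it, with a minus sign, exactly on `φ > φ₊`, where the edge
coordinate of `φ₊` is positive. The reflected wave lives on `φ < φ₋`, hence the opposite sign for
the edge coordinate of `φ₋`. -/
theorem scatteredWave_eq {α ω₀ : ℝ} (hα : Real.pi / 2 < α) (hα' : α < Real.pi) {f : ℝ → ℂ}
    (hF : IsTame (modulated ω₀ f)) {x : Plane} (hx : x ∈ Q) (h₁ : polarAngle x ≠ phiPlus α)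
    (h₂ : polarAngle x ≠ phiMinus α) (t : ℝ) :
    scatteredWave α ω₀ f x t =
      edgeWave (modulated ω₀ f) (edgeCoord (phiPlus α) x) (t - ‖x‖) +
        edgeWave (modulated ω₀ f) (-edgeCoord (phiMinus α) x) (t - ‖x‖) := by
  have hp := phiPlus_mem_Ioo hα hα'
  have hm := phiMinus_mem_Ioo hα hα'
  obtain ⟨i1, e1⟩ := integral_div_sinh_eq_edge hF hp hx h₁ t
  obtain ⟨i2, e2⟩ := integral_div_sinh_eq_edge hF hm hx h₂ t
  have hn1 : t - incidentPhase α x = t - ‖x‖ + 2 * edgeCoord (phiPlus α) x ^ 2 := by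
    rw [incidentPhase_eq, ← norm_sub_two_mul_edgeCoord_sq _ hx]; ring
  have hn2 : t - reflectedPhase α x = t - ‖x‖ + 2 * edgeCoord (phiMinus α) x ^ 2 := by
    rw [reflectedPhase_eq, ← norm_sub_two_mul_edgeCoord_sq _ hx]; ring
  have hd : diffractedWave α ω₀ f x t = 1 / (2 * Real.pi) *
      (SignType.sign (edgeCoord (phiPlus α) x) *
        (∫ σ : ℝ, modulated ω₀ f (t - ‖x‖ - 2 * edgeCoord (phiPlus α) x ^ 2 * σ ^ 2) /
          (1 + (σ : ℂ) ^ 2)) -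
      SignType.sign (edgeCoord (phiMinus α) x) *
        (∫ σ : ℝ, modulated ω₀ f (t - ‖x‖ - 2 * edgeCoord (phiMinus α) x ^ 2 * σ ^ 2) /
          (1 + (σ : ℂ) ^ 2))) := by
    have hsplit : ∀ β : ℝ, kernelZ α (β + 2 * Real.pi * Complex.I - Complex.I * polarAngle x) *
        modulated ω₀ f (t - ‖x‖ * Real.cosh β) =
        2 * (1 / Complex.sinh ((β - Complex.I * (polarAngle x - phiMinus α : ℝ)) / 2) *
          modulated ω₀ f (t - ‖x‖ * Real.cosh β)) -
        2 * (1 / Complex.sinh ((β - Complex.I * (polarAngle x - phiPlus α : ℝ)) / 2) *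
          modulated ω₀ f (t - ‖x‖ * Real.cosh β)) := fun β => by
      rw [kernelZ_eq]; ring
    rw [diffractedWave]
    simp_rw [hsplit]
    rw [integral_sub (i2.const_mul 2) (i1.const_mul 2), integral_const_mul, integral_const_mul,
      e1, e2]
    have hpi : (Real.pi : ℂ) ≠ 0 := by exact_mod_cast Real.pi_ne_zero
    have hI := Complex.I_sq
    field_simp
    rw [hI]
    ring
  have hi : screenedIncidentWave α ω₀ f x t - incidentWave α ω₀ f x t =
      -(if 0 < edgeCoord (phiPlus α) x then
        modulated ω₀ f (t - ‖x‖ + 2 * edgeCoord (phiPlus α) x ^ 2) else 0) := by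
    rw [screenedIncidentWave, incidentWave, hn1]
    rcases h₁.lt_or_gt with h | h
    · rw [if_pos h, if_neg ((edgeCoord_neg_iff hp hx).2 h).not_gt]; ring
    · rw [if_neg h.not_gt, if_pos ((edgeCoord_pos_iff hp hx).2 h)]; ring
  have hr : reflectedWave α ω₀ f x t =
      -(if 0 < -edgeCoord (phiMinus α) x then
        modulated ω₀ f (t - ‖x‖ + 2 * edgeCoord (phiMinus α) x ^ 2) else 0) := by
    rw [reflectedWave, hn2]
    rcases h₂.lt_or_gt with h | h
    · rw [if_pos h, if_pos (neg_pos.2 ((edgeCoord_neg_iff hm hx).2 h))]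
    · rw [if_neg h.not_gt, if_neg (neg_nonpos.2 ((edgeCoord_pos_iff hm hx).2 h).le).not_gt]; ring
  have hsneg : ((SignType.sign (-edgeCoord (phiMinus α) x) : SignType) : ℂ) =
      -(SignType.sign (edgeCoord (phiMinus α) x) : ℂ) := by
    rw [Left.sign_neg, SignType.coe_neg]
  rw [scatteredWave, totalWave, show ∀ a b c d : ℂ, a + b + c - d = (a - d) + b + c by
    intros; ring, hi, hr, hd, edgeWave, edgeWave, neg_sq, hsneg]
  ring

/-! ### Fourier–Laplace transforms of signals and of edge waves -/

theorem norm_cexp_I_mul (ω : ℂ) (t : ℝ) :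
    ‖Complex.exp (Complex.I * ω * t)‖ = Real.exp (-(ω.im * t)) := by
  rw [Complex.norm_exp, Complex.re_mul_ofReal]
  simp

theorem measurable_cexp_I_mul (ω : ℂ) : Measurable fun t : ℝ => Complex.exp (Complex.I * ω * t) := by
  fun_prop

theorem IsTame.integrable_cexp_mul {F : ℝ → ℂ} (hF : IsTame F) {ω : ℂ} (hω : 0 < ω.im) :
    Integrable fun s : ℝ => Complex.exp (Complex.I * ω * s) * F s := by
  obtain ⟨C, hC, N, h⟩ := hF.growth
  -- Half of the exponential decay absorbs the polynomial growth, through `(κ(1 + s))^N / N! ≤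
  -- e^{κ(1 + s)}`; the other half is integrable.
  set κ := ω.im / 2 with hκ
  have hκ0 : 0 < κ := by positivity
  have hi : Integrable (indicator (Ioi (0 : ℝ)) fun s =>
      C * (κ⁻¹ ^ N * N.factorial * Real.exp κ) * Real.exp (-κ * s)) :=
    (integrable_indicator_iff measurableSet_Ioi).2
      ((exp_neg_integrableOn_Ioi 0 hκ0).const_mul _)
  refine hi.mono' ((measurable_cexp_I_mul ω).mul hF.measurable).aestronglyMeasurable ?_
  have h0 : ∀ᵐ s : ℝ, s ≠ 0 := by simp [ae_iff, measure_singleton]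
  filter_upwards [h0] with s hs
  rcases hs.lt_or_gt with hs | hs
  · rw [hF.eq_zero_of_neg s hs, indicator_of_notMem (by simpa using hs.le)]
    simp
  · rw [indicator_of_mem (by exact hs), norm_mul, norm_cexp_I_mul]
    have h1 := h s
    rw [abs_of_pos hs] at h1
    have h2 := Real.pow_div_factorial_le_exp (κ * (1 + s)) (by positivity) N
    rw [div_le_iff₀ (by positivity), mul_pow] at h2
    have h3 : (1 + s) ^ N ≤ κ⁻¹ ^ N * N.factorial * Real.exp (κ * (1 + s)) := by
      have : (1 + s) ^ N = κ⁻¹ ^ N * (κ ^ N * (1 + s) ^ N) := by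
        rw [← mul_assoc, ← mul_pow, inv_mul_cancel₀ hκ0.ne', one_pow, one_mul]
      rw [this, mul_assoc]
      exact mul_le_mul_of_nonneg_left (by linarith) (by positivity)
    calc Real.exp (-(ω.im * s)) * ‖F s‖
        ≤ Real.exp (-(ω.im * s)) *
          (C * (κ⁻¹ ^ N * N.factorial * Real.exp (κ * (1 + s)))) := by
          gcongr
          exact h1.trans (by gcongr)
      _ = C * (κ⁻¹ ^ N * N.factorial) *
          (Real.exp (-(ω.im * s)) * Real.exp (κ * (1 + s))) := by ring
      _ = C * (κ⁻¹ ^ N * N.factorial) * (Real.exp κ * Real.exp (-κ * s)) := by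
          rw [← Real.exp_add, ← Real.exp_add, hκ]; ring_nf
      _ = _ := by ring

theorem IsTame.id_mul {F : ℝ → ℂ} (hF : IsTame F) : IsTame fun s => s * F s := by
  obtain ⟨C, hC, N, h⟩ := hF.growth
  refine ⟨Complex.measurable_ofReal.mul hF.measurable, fun s hs => by
    simp [hF.eq_zero_of_neg s hs], C, hC, N + 1, fun s => ?_⟩
  rw [norm_mul, Complex.norm_real, Real.norm_eq_abs, pow_succ']
  calc |s| * ‖F s‖ ≤ (1 + |s|) * (C * (1 + |s|) ^ N) := by
        gcongr
        · linarith
        · exact h s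
    _ = _ := by ring

/-- The transform `∫ e^{iωs} F(s) ds` of a causal signal. -/
def signalTransform (F : ℝ → ℂ) (ω : ℂ) : ℂ := ∫ s : ℝ, Complex.exp (Complex.I * ω * s) * F s

theorem IsTame.differentiableAt_signalTransform {F : ℝ → ℂ} (hF : IsTame F) {ω : ℂ}
    (hω : 0 < ω.im) : DifferentiableAt ℂ (signalTransform F) ω := by
  set κ := ω.im / 2 with hκ
  -- On `Im η > κ` the differentiated integrand is dominated by its modulus at the single frequency
  -- `iκ`.
  have hκ0 : 0 < (Complex.I * κ).im := by simp [hκ]; linarith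
  have hopen : {η : ℂ | κ < η.im} ∈ 𝓝 ω :=
    (isOpen_lt continuous_const Complex.continuous_im).mem_nhds (by
      change κ < ω.im
      rw [hκ]; linarith)
  refine (hasDerivAt_integral_of_dominated_loc_of_deriv_le (μ := volume) (x₀ := ω)
    (F := fun (η : ℂ) (s : ℝ) => Complex.exp (Complex.I * η * s) * F s)
    (F' := fun (η : ℂ) (s : ℝ) => Complex.I * s * (Complex.exp (Complex.I * η * s) * F s))
    (bound := fun s : ℝ => ‖Complex.exp (Complex.I * (Complex.I * κ) * s) * (s * F s)‖)
    hopen (Eventually.of_forall fun η =>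
      ((measurable_cexp_I_mul η).mul hF.measurable).aestronglyMeasurable)
    (hF.integrable_cexp_mul hω) ?_ (Eventually.of_forall fun s η hη => ?_)
    (hF.id_mul.integrable_cexp_mul hκ0).norm (Eventually.of_forall fun s η _ => ?_)).2.differentiableAt
  · exact ((measurable_const.mul Complex.measurable_ofReal).mul
      ((measurable_cexp_I_mul ω).mul hF.measurable)).aestronglyMeasurable
  · rcases lt_or_ge s 0 with hs | hs
    · simp [hF.eq_zero_of_neg s hs]
    · have hη' : κ < η.im := hη
      have e : (Complex.I * (κ : ℂ)).im = κ := by simp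
      rw [norm_mul, norm_mul, norm_mul, norm_mul, norm_mul, norm_cexp_I_mul, norm_cexp_I_mul,
        Complex.norm_I, one_mul, e]
      have : Real.exp (-(η.im * s)) ≤ Real.exp (-(κ * s)) :=
        Real.exp_le_exp.2 (by nlinarith)
      calc ‖(s : ℂ)‖ * (Real.exp (-(η.im * s)) * ‖F s‖)
          ≤ ‖(s : ℂ)‖ * (Real.exp (-(κ * s)) * ‖F s‖) := by gcongr
        _ = _ := by ring
  · have h1 : HasDerivAt (fun η : ℂ => Complex.I * η * s) (Complex.I * 1 * s) η :=
      ((hasDerivAt_id η).const_mul Complex.I).mul_const (s : ℂ)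
    refine (h1.cexp.mul_const (F s)).congr_deriv ?_
    ring

theorem IsTame.integrable_shift {F : ℝ → ℂ} (hF : IsTame F) {ω : ℂ} (hω : 0 < ω.im) (b : ℝ) :
    Integrable fun t : ℝ => Complex.exp (Complex.I * ω * t) * F (t - b) := by
  refine (((hF.integrable_cexp_mul hω).comp_sub_right b).const_mul
    (Complex.exp (Complex.I * ω * b))).congr (Eventually.of_forall fun t => ?_)
  simp only
  rw [← mul_assoc, ← Complex.exp_add]
  push_cast
  ring_nf

theorem integral_cexp_mul_shift (F : ℝ → ℂ) (ω : ℂ) (b : ℝ) :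
    ∫ t : ℝ, Complex.exp (Complex.I * ω * t) * F (t - b) =
      Complex.exp (Complex.I * ω * b) * signalTransform F ω := by
  rw [signalTransform, ← integral_sub_right_eq_self
    (fun s : ℝ => Complex.exp (Complex.I * ω * s) * F s) b, ← integral_const_mul]
  congr 1
  funext t
  rw [← mul_assoc, ← Complex.exp_add]
  push_cast
  ring_nf

theorem integral_norm_cexp_mul_shift (F : ℝ → ℂ) (ω : ℂ) (b : ℝ) :
    ∫ t : ℝ, ‖Complex.exp (Complex.I * ω * t) * F (t - b)‖ =
      Real.exp (-(ω.im * b)) * ∫ s : ℝ, ‖Complex.exp (Complex.I * ω * s) * F s‖ := by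
  rw [← integral_sub_right_eq_self (fun s : ℝ => ‖Complex.exp (Complex.I * ω * s) * F s‖) b,
    ← integral_const_mul]
  congr 1
  funext t
  rw [norm_mul, norm_mul, norm_cexp_I_mul, norm_cexp_I_mul, ← mul_assoc, ← Real.exp_add]
  ring_nf

/-- Justifies Fubini: the additional delay `2r²σ²` is nonnegative and only decreases the weighted
`L¹` norm in time, so the Cauchy density alone gives integrability in `σ`. -/
theorem IsTame.integrable_cauchy_prod {F : ℝ → ℂ} (hF : IsTame F) {ω : ℂ} (hω : 0 < ω.im)
    (a r : ℝ) : Integrable (fun p : ℝ × ℝ => Complex.exp (Complex.I * ω * p.2) *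
      F (p.2 - (a + 2 * r ^ 2 * p.1 ^ 2)) / (1 + (p.1 : ℂ) ^ 2)) (volume.prod volume) := by
  have hm : Measurable fun p : ℝ × ℝ => Complex.exp (Complex.I * ω * p.2) *
      F (p.2 - (a + 2 * r ^ 2 * p.1 ^ 2)) / (1 + (p.1 : ℂ) ^ 2) := by
    refine Measurable.div (Measurable.mul (by fun_prop) ?_) (by fun_prop)
    exact hF.measurable.comp (by fun_prop)
  rw [integrable_prod_iff hm.aestronglyMeasurable]
  refine ⟨Eventually.of_forall fun σ => ?_, ?_⟩
  · exact (hF.integrable_shift hω (a + 2 * r ^ 2 * σ ^ 2)).div_const (1 + (σ : ℂ) ^ 2)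
  · have hm' := (hm.aestronglyMeasurable (μ := volume.prod volume)).norm.integral_prod_right'
    refine (integrable_inv_one_add_sq.const_mul (Real.exp (-(ω.im * a)) *
      ∫ s : ℝ, ‖Complex.exp (Complex.I * ω * s) * F s‖)).mono' hm'
      (Eventually.of_forall fun σ => ?_)
    have hI : 0 ≤ ∫ s : ℝ, ‖Complex.exp (Complex.I * ω * s) * F s‖ :=
      integral_nonneg fun s => norm_nonneg _
    simp only [norm_div, norm_one_add_sq]
    rw [integral_div, integral_norm_cexp_mul_shift, div_eq_mul_inv,
      Real.norm_of_nonneg (by positivity)]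
    gcongr
    have : 0 ≤ 2 * r ^ 2 * σ ^ 2 := by positivity
    linarith

theorem integral_cauchy_eq {F : ℝ → ℂ} (hF : IsTame F) {ω : ℂ} (hω : 0 < ω.im) (a r : ℝ) :
    Integrable (fun t : ℝ => Complex.exp (Complex.I * ω * t) *
      ∫ σ : ℝ, F (t - a - 2 * r ^ 2 * σ ^ 2) / (1 + (σ : ℂ) ^ 2)) ∧
    ∫ t : ℝ, Complex.exp (Complex.I * ω * t) *
      ∫ σ : ℝ, F (t - a - 2 * r ^ 2 * σ ^ 2) / (1 + (σ : ℂ) ^ 2) =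
    Complex.exp (Complex.I * ω * a) * signalTransform F ω *
      ∫ σ : ℝ, Complex.exp (2 * Complex.I * ω * r ^ 2 * (σ : ℂ) ^ 2) / (1 + (σ : ℂ) ^ 2) := by
  have hi := hF.integrable_cauchy_prod hω a r
  have e1 : ∀ t : ℝ, Complex.exp (Complex.I * ω * t) *
      ∫ σ : ℝ, F (t - a - 2 * r ^ 2 * σ ^ 2) / (1 + (σ : ℂ) ^ 2) =
      ∫ σ : ℝ, Complex.exp (Complex.I * ω * t) *
        F (t - (a + 2 * r ^ 2 * σ ^ 2)) / (1 + (σ : ℂ) ^ 2) := fun t => by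
    rw [← integral_const_mul]
    congr 1
    funext σ
    rw [sub_sub, mul_div_assoc]
  simp_rw [e1]
  refine ⟨hi.integral_prod_right, ?_⟩
  rw [integral_integral_swap (f := fun (t σ : ℝ) => Complex.exp (Complex.I * ω * t) *
        F (t - (a + 2 * r ^ 2 * σ ^ 2)) / (1 + (σ : ℂ) ^ 2)) hi.swap, ← integral_const_mul]
  congr 1
  funext σ
  rw [integral_div, integral_cexp_mul_shift, ← mul_div_assoc]
  congr 1
  have e2 : Complex.exp (Complex.I * ω * ((a + 2 * r ^ 2 * σ ^ 2 : ℝ) : ℂ)) =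
      Complex.exp (Complex.I * ω * a) *
        Complex.exp (2 * Complex.I * ω * r ^ 2 * (σ : ℂ) ^ 2) := by
    rw [← Complex.exp_add]
    push_cast
    ring_nf
  rw [e2]
  ring

/-- The square root `(-2iω)^{1/2}` with positive real part. -/
def waveRoot (ω : ℂ) : ℂ := (-2 * Complex.I * ω) ^ (2⁻¹ : ℂ)

theorem waveRoot_sq (ω : ℂ) : waveRoot ω ^ 2 = -2 * Complex.I * ω :=
  Complex.cpow_ofNat_inv_pow _ 2

theorem waveRoot_arg_re (ω : ℂ) : (-2 * Complex.I * ω).re = 2 * ω.im := by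
  simp

theorem waveRoot_sq_re_pos {ω : ℂ} (hω : 0 < ω.im) : 0 < (waveRoot ω ^ 2).re := by
  rw [waveRoot_sq, waveRoot_arg_re]; linarith

theorem waveRoot_re_pos {ω : ℂ} (hω : 0 < ω.im) : 0 < (waveRoot ω).re := by
  have hne : (-2 * Complex.I * ω) ≠ 0 := by
    intro h
    have := waveRoot_arg_re ω
    rw [h] at this
    simp at this
    linarith
  have hpos : 0 < (-2 * Complex.I * ω).re := by rw [waveRoot_arg_re]; linarith
  have harg := Complex.abs_arg_lt_pi_div_two_iff.2 (Or.inl hpos)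
  have h2 : (2⁻¹ : ℂ) = ((1 / 2 : ℝ) : ℂ) := by push_cast; norm_num
  rw [waveRoot, h2, Complex.cpow_ofReal_re]
  have hp : 0 < ‖-2 * Complex.I * ω‖ := norm_pos_iff.2 hne
  refine mul_pos (Real.rpow_pos_of_pos hp _) (Real.cos_pos_of_mem_Ioo ?_)
  obtain ⟨h3, h4⟩ := abs_lt.1 harg
  constructor <;> linarith [Real.pi_pos]

/-- A delay becomes an exponential factor, so the Cauchy average and the plane wave become the two
terms of `transition_mul_ofReal` with `c² = -2iω`. -/
theorem fourierLaplace_edgeWave {F : ℝ → ℂ} (hF : IsTame F) {ω : ℂ} (hω : 0 < ω.im) (a : ℝ)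
    {r : ℝ} (hr : r ≠ 0) :
    Integrable (fun t : ℝ => Complex.exp (Complex.I * ω * t) * edgeWave F r (t - a)) ∧
    ∫ t : ℝ, Complex.exp (Complex.I * ω * t) * edgeWave F r (t - a) =
      signalTransform F ω * (Complex.exp (Complex.I * ω * a) * transition (waveRoot ω * r)) := by
  obtain ⟨i1, h1⟩ := integral_cauchy_eq hF hω a r
  have e : ∀ t : ℝ, Complex.exp (Complex.I * ω * t) * edgeWave F r (t - a) =
      SignType.sign r / (2 * Real.pi) * (Complex.exp (Complex.I * ω * t) *
        ∫ σ : ℝ, F (t - a - 2 * r ^ 2 * σ ^ 2) / (1 + (σ : ℂ) ^ 2)) -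
      (if 0 < r then (1 : ℂ) else 0) *
        (Complex.exp (Complex.I * ω * t) * F (t - (a - 2 * r ^ 2))) := fun t => by
    rw [edgeWave, show t - (a - 2 * r ^ 2) = t - a + 2 * r ^ 2 by ring]
    split_ifs <;> ring
  have i2 := hF.integrable_shift hω (a - 2 * r ^ 2)
  simp_rw [e]
  refine ⟨(i1.const_mul _).sub (i2.const_mul _), ?_⟩
  rw [integral_sub (i1.const_mul _) (i2.const_mul _), integral_const_mul, integral_const_mul, h1,
    integral_cexp_mul_shift, transition_mul_ofReal (waveRoot_re_pos hω) (waveRoot_sq_re_pos hω) hr,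
    waveRoot_sq]
  have e2 : ∀ σ : ℝ, Complex.exp (-(-2 * Complex.I * ω * (r : ℂ) ^ 2) * (σ : ℂ) ^ 2) =
      Complex.exp (2 * Complex.I * ω * r ^ 2 * (σ : ℂ) ^ 2) := fun σ => by ring_nf
  have e3 : Complex.exp (Complex.I * ω * ((a - 2 * r ^ 2 : ℝ) : ℂ)) =
      Complex.exp (Complex.I * ω * a) * Complex.exp (-2 * Complex.I * ω * (r : ℂ) ^ 2) := by
    rw [← Complex.exp_add]; push_cast; ring_nf
  simp_rw [e2]
  rw [e3]
  split_ifs <;> ring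

/-- The signal is sampled only at times at most `t`. The Cauchy average contributes `M / 2` and the
plane wave `M`; with `M = 0` this yields causality. -/
theorem norm_edgeWave_le {F : ℝ → ℂ} {M t r τ : ℝ} (hM : ∀ s ≤ t, ‖F s‖ ≤ M) (hτ : τ ≤ t)
    (hr : 0 < r → τ + 2 * r ^ 2 ≤ t) : ‖edgeWave F r τ‖ ≤ 2 * M := by
  have hM0 : 0 ≤ M := (norm_nonneg _).trans (hM t le_rfl)
  have h1 : ‖∫ σ : ℝ, F (τ - 2 * r ^ 2 * σ ^ 2) / (1 + (σ : ℂ) ^ 2)‖ ≤ M * Real.pi := by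
    rw [← integral_univ_inv_one_add_sq, ← integral_const_mul]
    refine norm_integral_le_of_norm_le (integrable_inv_one_add_sq.const_mul M)
      (Eventually.of_forall fun σ => ?_)
    rw [norm_div, norm_one_add_sq, div_eq_mul_inv]
    gcongr
    refine hM _ ?_
    have : 0 ≤ 2 * r ^ 2 * σ ^ 2 := by positivity
    linarith
  have h2 : ‖((SignType.sign r : SignType) : ℂ)‖ ≤ 1 := by
    rcases SignType.trichotomy (SignType.sign r) with h | h | h <;> simp [h]
  have h3 : ‖(2 * Real.pi : ℂ)‖ = 2 * Real.pi := by
    rw [norm_mul, Complex.norm_real, Real.norm_of_nonneg Real.pi_pos.le]; simp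
  have h4 : ‖(if 0 < r then F (τ + 2 * r ^ 2) else 0)‖ ≤ M := by
    split_ifs with h
    · exact hM _ (hr h)
    · simpa using hM0
  have hpi := Real.pi_pos
  rw [edgeWave]
  refine (norm_sub_le _ _).trans ?_
  rw [norm_mul, norm_div, h3]
  calc _ ≤ 1 / (2 * Real.pi) * (M * Real.pi) + M := by gcongr
    _ = M / 2 + M := by field_simp
    _ ≤ 2 * M := by linarith

/-! ### The Fourier–Laplace transform of the scattered wave -/

/-- The Fourier–Laplace transform of the scattered wave generated by the signal `F`. -/
def transformedWave (α : ℝ) (F : ℝ → ℂ) (ω : ℂ) (x : Plane) : ℂ :=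
  signalTransform F ω *
    (Complex.exp (Complex.I * ω * ‖x‖) * transition (waveRoot ω * edgeCoord (phiPlus α) x) +
      Complex.exp (Complex.I * ω * ‖x‖) *
        transition (waveRoot ω * (-edgeCoord (phiMinus α) x : ℝ)))

/-- Where this plane wave is present, `0 < φ - φ₊ < π - α`, so `cos (φ - φ₊) ≥ cos (π - α)`. The
constant `-cos α` is positive because `α > π/2`. -/
theorem neg_cos_mul_norm_le_phiPlus {α : ℝ} (hα : Real.pi / 2 < α) (hα' : α < Real.pi) {x : Plane}
    (hx : x ∈ Q) (h : 0 < edgeCoord (phiPlus α) x) :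
    -Real.cos α * ‖x‖ ≤ ‖x‖ - 2 * edgeCoord (phiPlus α) x ^ 2 := by
  rw [norm_sub_two_mul_edgeCoord_sq _ hx, mul_comm]
  have h1 := (edgeCoord_pos_iff (phiPlus_mem_Ioo hα hα') hx).1 h
  have h2 := (polarAngle_mem_Ioo hx).2
  refine mul_le_mul_of_nonneg_left ?_ (norm_nonneg x)
  rw [← Real.cos_pi_sub]
  refine Real.cos_le_cos_of_nonneg_of_le_pi (by linarith) (by linarith [Real.pi_pos]) ?_
  unfold phiPlus
  linarith

theorem neg_cos_mul_norm_le_phiMinus {α : ℝ} (hα : Real.pi / 2 < α) (hα' : α < Real.pi)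
    {x : Plane} (hx : x ∈ Q) (h : 0 < -edgeCoord (phiMinus α) x) :
    -Real.cos α * ‖x‖ ≤ ‖x‖ - 2 * (-edgeCoord (phiMinus α) x) ^ 2 := by
  rw [neg_sq, norm_sub_two_mul_edgeCoord_sq _ hx, mul_comm]
  have h1 := (edgeCoord_neg_iff (phiMinus_mem_Ioo hα hα') hx).1 (neg_pos.1 h)
  have h2 := (polarAngle_mem_Ioo hx).1
  refine mul_le_mul_of_nonneg_left ?_ (norm_nonneg x)
  rw [← Real.cos_pi_sub, ← Real.cos_neg (polarAngle x - _)]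
  refine Real.cos_le_cos_of_nonneg_of_le_pi (by linarith) (by linarith [Real.pi_pos]) ?_
  unfold phiMinus
  linarith

theorem neg_cos_pos {α : ℝ} (hα : Real.pi / 2 < α) (hα' : α < Real.pi) : 0 < -Real.cos α :=
  neg_pos.2 (Real.cos_neg_of_pi_div_two_lt_of_lt hα (by linarith [Real.pi_pos]))

theorem norm_scatteredWave_le {α ω₀ : ℝ} (hα : Real.pi / 2 < α) (hα' : α < Real.pi) {f : ℝ → ℂ}
    (hF : IsTame (modulated ω₀ f)) {x : Plane} (hx : x ∈ Q) (h₁ : polarAngle x ≠ phiPlus α)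
    (h₂ : polarAngle x ≠ phiMinus α) {t M : ℝ} (hM : ∀ s ≤ t, ‖modulated ω₀ f s‖ ≤ M) :
    ‖scatteredWave α ω₀ f x t‖ ≤ 4 * M := by
  rw [scatteredWave_eq hα hα' hF hx h₁ h₂]
  have hρ := norm_pos_of_mem_Q hx
  have hc := neg_cos_pos hα hα'
  have hcρ := mul_pos hc hρ
  refine (norm_add_le _ _).trans ?_
  have e1 := norm_edgeWave_le (r := edgeCoord (phiPlus α) x) (τ := t - ‖x‖) hM (by linarith)
    fun h => by linarith [neg_cos_mul_norm_le_phiPlus hα hα' hx h]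
  have e2 := norm_edgeWave_le (r := -edgeCoord (phiMinus α) x) (τ := t - ‖x‖) hM (by linarith)
    fun h => by linarith [neg_cos_mul_norm_le_phiMinus hα hα' hx h]
  linarith

theorem scatteredWave_eq_zero_of_neg {α ω₀ : ℝ} (hα : Real.pi / 2 < α) (hα' : α < Real.pi)
    {f : ℝ → ℂ} (hF : IsTame (modulated ω₀ f)) {x : Plane} (hx : x ∈ Q)
    (h₁ : polarAngle x ≠ phiPlus α) (h₂ : polarAngle x ≠ phiMinus α) {t : ℝ} (ht : t < 0) :
    scatteredWave α ω₀ f x t = 0 := by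
  have := norm_scatteredWave_le hα hα' hF hx h₁ h₂ (t := t) (M := 0) fun s hs => by
    rw [hF.eq_zero_of_neg s (hs.trans_lt ht), norm_zero]
  rw [mul_zero] at this
  exact norm_le_zero_iff.1 this

theorem integrable_cexp_mul_scatteredWave {α ω₀ : ℝ} (hα : Real.pi / 2 < α) (hα' : α < Real.pi)
    {f : ℝ → ℂ} (hF : IsTame (modulated ω₀ f)) {x : Plane} (hx : x ∈ Q)
    (h₁ : polarAngle x ≠ phiPlus α) (h₂ : polarAngle x ≠ phiMinus α) {ω : ℂ} (hω : 0 < ω.im) :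
    Integrable (fun t : ℝ => Complex.exp (Complex.I * ω * t) * scatteredWave α ω₀ f x t) ∧
      ∫ t : ℝ, Complex.exp (Complex.I * ω * t) * scatteredWave α ω₀ f x t =
        transformedWave α (modulated ω₀ f) ω x := by
  obtain ⟨i1, e1⟩ := fourierLaplace_edgeWave hF hω ‖x‖
    (edgeCoord_ne_zero (phiPlus_mem_Ioo hα hα') hx h₁)
  obtain ⟨i2, e2⟩ := fourierLaplace_edgeWave hF hω ‖x‖
    (neg_ne_zero.2 (edgeCoord_ne_zero (phiMinus_mem_Ioo hα hα') hx h₂))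
  simp_rw [scatteredWave_eq hα hα' hF hx h₁ h₂, mul_add]
  refine ⟨i1.add i2, ?_⟩
  rw [integral_add i1 i2, e1, e2, transformedWave, mul_add]

theorem fourierLaplace_scatteredWave {α ω₀ : ℝ} (hα : Real.pi / 2 < α) (hα' : α < Real.pi)
    {f : ℝ → ℂ} (hF : IsTame (modulated ω₀ f)) {x : Plane} (hx : x ∈ Q)
    (h₁ : polarAngle x ≠ phiPlus α) (h₂ : polarAngle x ≠ phiMinus α) {ω : ℂ} (hω : 0 < ω.im) :
    fourierLaplace (scatteredWave α ω₀ f x) ω = transformedWave α (modulated ω₀ f) ω x := by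
  rw [← (integrable_cexp_mul_scatteredWave hα hα' hF hx h₁ h₂ hω).2, fourierLaplace]
  refine setIntegral_eq_integral_of_ae_compl_eq_zero ?_
  have h0 : ∀ᵐ s : ℝ, s ≠ 0 := by simp [ae_iff, measure_singleton]
  filter_upwards [h0] with t ht ht'
  rw [scatteredWave_eq_zero_of_neg hα hα' hF hx h₁ h₂
    (lt_of_le_of_ne (not_lt.1 fun h => ht' h) ht), mul_zero]

/-! ### Analyticity, decay and Sobolev regularity of the transformed wave. -/

section Smoothness

open scoped ContDiff

theorem contDiffAt_real_of_differentiableOn {g : ℂ → ℂ} {U : Set ℂ} (hU : IsOpen U)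
    (hg : DifferentiableOn ℂ g U) {z : ℂ} (hz : z ∈ U) : ContDiffAt ℝ ω g z :=
  ((hg.analyticAt (hU.mem_nhds hz)).restrictScalars (𝕜 := ℝ)).contDiffAt

theorem differentiableAt_waveRoot {z : ℂ} (hz : 0 < z.im) : DifferentiableAt ℂ waveRoot z := by
  refine DifferentiableAt.cpow_const (by fun_prop) (Or.inl ?_)
  rw [waveRoot_arg_re]
  linarith

theorem isOpen_upperHalfPlane : IsOpen {z : ℂ | 0 < z.im} :=
  isOpen_lt continuous_const Complex.continuous_im

theorem contDiffOn_transformedWave (α : ℝ) {F : ℝ → ℂ} (hF : IsTame F) :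
    ContDiffOn ℝ ω (fun z : ℂ × Plane => transformedWave α F z.1 z.2)
      ({z : ℂ | 0 < z.im} ×ˢ Q) := by
  rintro ⟨ζ, x⟩ ⟨hζ, hx⟩
  refine ContDiffAt.contDiffWithinAt ?_
  have hT : ∀ z, ContDiffAt ℝ ω transition z := fun z =>
    contDiffAt_real_of_differentiableOn isOpen_univ differentiable_transition.differentiableOn
      (mem_univ z)
  have h1 : ContDiffAt ℝ ω (signalTransform F) ζ :=
    contDiffAt_real_of_differentiableOn isOpen_upperHalfPlane
      (fun z hz => (hF.differentiableAt_signalTransform hz).differentiableWithinAt) hζ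
  have h2 : ContDiffAt ℝ ω waveRoot ζ :=
    contDiffAt_real_of_differentiableOn isOpen_upperHalfPlane
      (fun z hz => (differentiableAt_waveRoot hz).differentiableWithinAt) hζ
  have h1' : ContDiffAt ℝ ω (fun z : ℂ × Plane => signalTransform F z.1) (ζ, x) :=
    ContDiffAt.comp (g := signalTransform F) (f := Prod.fst) (ζ, x) h1 contDiffAt_fst
  have h2' : ContDiffAt ℝ ω (fun z : ℂ × Plane => waveRoot z.1) (ζ, x) :=
    ContDiffAt.comp (g := waveRoot) (f := Prod.fst) (ζ, x) h2 contDiffAt_fst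
  have hn : ContDiffAt ℝ ω (fun z : ℂ × Plane => ((‖z.2‖ : ℝ) : ℂ)) (ζ, x) :=
    Complex.ofRealCLM.contDiff.contDiffAt.comp (ζ, x)
      (contDiffAt_snd.norm ℝ (norm_pos_iff.1 (norm_pos_of_mem_Q hx)))
  have he : ContDiffAt ℝ ω (fun z : ℂ × Plane => Complex.exp (Complex.I * z.1 * ‖z.2‖)) (ζ, x) :=
    ContDiffAt.cexp ((contDiffAt_const.mul contDiffAt_fst).mul hn)
  have hr : ∀ θ, ContDiffAt ℝ ω (fun z : ℂ × Plane => edgeCoord θ z.2) (ζ, x) := fun θ =>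
    (contDiffAt_edgeCoord θ hx).comp (ζ, x) contDiffAt_snd
  have hp : ContDiffAt ℝ ω
      (fun z : ℂ × Plane => transition (waveRoot z.1 * edgeCoord (phiPlus α) z.2)) (ζ, x) :=
    (hT _).comp (ζ, x)
      (f := fun z : ℂ × Plane => waveRoot z.1 * edgeCoord (phiPlus α) z.2)
      (h2'.mul (Complex.ofRealCLM.contDiff.contDiffAt.comp (ζ, x) (hr _)))
  have hm : ContDiffAt ℝ ω (fun z : ℂ × Plane =>
      transition (waveRoot z.1 * (-edgeCoord (phiMinus α) z.2 : ℝ))) (ζ, x) :=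
    (hT _).comp (ζ, x)
      (f := fun z : ℂ × Plane => waveRoot z.1 * (-edgeCoord (phiMinus α) z.2 : ℝ))
      (h2'.mul (Complex.ofRealCLM.contDiff.contDiffAt.comp (ζ, x) (hr _).neg))
  exact h1'.mul ((he.mul hp).add (he.mul hm))

end Smoothness

theorem differentiableAt_transformedWave (α : ℝ) {F : ℝ → ℂ} (hF : IsTame F) {ζ : ℂ}
    (hζ : 0 < ζ.im) (x : Plane) : DifferentiableAt ℂ (fun η => transformedWave α F η x) ζ := by
  have h1 := hF.differentiableAt_signalTransform hζ
  have h2 := differentiableAt_waveRoot hζ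
  have hT : ∀ r : ℝ, DifferentiableAt ℂ (fun η => transition (waveRoot η * r)) ζ := fun r =>
    (differentiable_transition _).comp ζ (h2.mul_const _)
  have he : DifferentiableAt ℂ (fun η : ℂ => Complex.exp (Complex.I * η * ‖x‖)) ζ := by fun_prop
  exact h1.mul ((he.mul (hT _)).add (he.mul (hT _)))

theorem isHolomorphicIntoC2_transformedWave (α : ℝ) {F : ℝ → ℂ} (hF : IsTame F) :
    IsHolomorphicIntoC2 Q (transformedWave α F) :=
  isHolomorphicIntoC2_of_contDiffOn isOpen_Q (contDiffOn_transformedWave α hF)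
    fun z hz => differentiableAt_transformedWave α hF hz.1 z.2

/-- The growth `e^{2 Im ω r²}` of `transition` is beaten by `e^{-Im ω ρ}` thanks to `κρ ≤ ρ - 2r²`.
The constant is `1/2` from the Cauchy part plus `1` from the plane wave. -/
theorem norm_exp_mul_transition_le {ω : ℂ} (hω : 0 < ω.im) {κ ρ r : ℝ} (hκ : κ ≤ 1) (hρ : 0 ≤ ρ)
    (hr : 0 < r → κ * ρ ≤ ρ - 2 * r ^ 2) :
    ‖Complex.exp (Complex.I * ω * ρ) * transition (waveRoot ω * r)‖ ≤
      3 / 2 * Real.exp (-(ω.im * κ) * ρ) := by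
  have h := norm_transition_le (waveRoot_re_pos hω) (waveRoot_sq_re_pos hω) r
  rw [waveRoot_sq, waveRoot_arg_re] at h
  rw [norm_mul, norm_cexp_I_mul]
  have h1 : Real.exp (-(ω.im * ρ)) ≤ Real.exp (-(ω.im * κ) * ρ) := by
    refine Real.exp_le_exp.2 ?_
    have := mul_le_mul_of_nonneg_left (mul_le_mul_of_nonneg_right hκ hρ) hω.le
    linarith
  have h2 : Real.exp (-(ω.im * ρ)) * (if 0 < r then Real.exp (2 * ω.im * r ^ 2) else 0) ≤
      Real.exp (-(ω.im * κ) * ρ) := by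
    split_ifs with h0
    · rw [← Real.exp_add]
      refine Real.exp_le_exp.2 ?_
      have := mul_le_mul_of_nonneg_left (hr h0) hω.le
      linarith
    · simpa using (Real.exp_pos _).le
  calc _ ≤ Real.exp (-(ω.im * ρ)) *
        (1 / 2 + if 0 < r then Real.exp (2 * ω.im * r ^ 2) else 0) := by gcongr
    _ = 1 / 2 * Real.exp (-(ω.im * ρ)) +
        Real.exp (-(ω.im * ρ)) * (if 0 < r then Real.exp (2 * ω.im * r ^ 2) else 0) := by ring
    _ ≤ _ := by linarith

/-- The differential equation `T' = 2zT - 1/√π` reduces the gradient to the value bound. -/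
theorem hasFDerivAt_exp_mul_transition {ω : ℂ} (hω : 0 < ω.im) {κ : ℝ} (hκ : κ ≤ 1)
    {r : Plane → ℝ} {x : Plane} (hx : x ≠ 0) {L : Plane →L[ℝ] ℝ} (hL : HasFDerivAt r L x)
    (hLn : ‖L‖ ≤ (√‖x‖)⁻¹) (hrx : |r x| ≤ √‖x‖) (hr : 0 < r x → κ * ‖x‖ ≤ ‖x‖ - 2 * r x ^ 2) :
    ∃ L' : Plane →L[ℝ] ℂ,
      HasFDerivAt (fun x => Complex.exp (Complex.I * ω * ‖x‖) * transition (waveRoot ω * r x))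
        L' x ∧
      ‖L'‖ ≤ (3 / 2 * (‖ω‖ + 2 * ‖waveRoot ω‖ ^ 2) + ‖waveRoot ω‖) *
        ((1 + (√‖x‖)⁻¹) * Real.exp (-(ω.im * κ) * ‖x‖)) := by
  set c := waveRoot ω with hc
  have hxp : 0 < ‖x‖ := norm_pos_iff.2 hx
  have hsp : 0 < √‖x‖ := Real.sqrt_pos.2 hxp
  have hN : HasFDerivAt (fun x : Plane => ‖x‖) (fderiv ℝ (fun x : Plane => ‖x‖) x) x :=
    ((contDiffAt_norm ℝ hx (n := 1)).differentiableAt (by simp)).hasFDerivAt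
  set N := fderiv ℝ (fun x : Plane => ‖x‖) x with hNdef
  have hNn : ‖N‖ ≤ 1 := by
    simpa using norm_fderiv_le_of_lipschitz ℝ (x₀ := x) (lipschitzWith_one_norm (E := Plane))
  have h1 := (((Complex.ofRealCLM.hasFDerivAt.comp x hN).const_mul (Complex.I * ω))).cexp
  have h2 := ((hasDerivAt_transition (c * r x)).hasFDerivAt.restrictScalars ℝ).comp x
    ((Complex.ofRealCLM.hasFDerivAt.comp x hL).const_mul c)
  have h3 := h1.mul h2
  refine ⟨_, h3, ContinuousLinearMap.opNorm_le_bound _ (by positivity) fun v => ?_⟩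
  set e : ℂ := Complex.exp (Complex.I * ω * ‖x‖) with he
  set T : ℂ := transition (c * r x) with hT
  set W : ℝ := Real.exp (-(ω.im * κ) * ‖x‖) with hW
  have hval : ‖e * T‖ ≤ 3 / 2 * W := norm_exp_mul_transition_le hω hκ hxp.le hr
  have hev : ‖e‖ ≤ W := by
    rw [he, norm_cexp_I_mul]
    refine Real.exp_le_exp.2 ?_
    have := mul_le_mul_of_nonneg_left (mul_le_mul_of_nonneg_right hκ hxp.le) hω.le
    linarith
  have hNv : ‖(N v : ℂ)‖ ≤ ‖v‖ := by
    rw [Complex.norm_real]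
    simpa using N.le_of_opNorm_le hNn v
  have hLv : ‖(L v : ℂ)‖ ≤ (√‖x‖)⁻¹ * ‖v‖ := by
    rw [Complex.norm_real]
    exact L.le_of_opNorm_le hLn v
  have hrL : ‖(r x : ℂ)‖ * ‖(L v : ℂ)‖ ≤ ‖v‖ := by
    rw [Complex.norm_real, Real.norm_eq_abs]
    calc |r x| * ‖(L v : ℂ)‖ ≤ √‖x‖ * ((√‖x‖)⁻¹ * ‖v‖) := by gcongr
      _ = ‖v‖ := by field_simp
  have hpi : ‖(1 / √Real.pi : ℂ)‖ ≤ 1 := by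
    have h1 : (1 : ℝ) ≤ √Real.pi := Real.one_le_sqrt.2 (by linarith [Real.pi_gt_three])
    rw [norm_div, norm_one, Complex.norm_real, Real.norm_of_nonneg (by positivity)]
    exact (div_le_one (by positivity)).2 h1
  have expand : ∀ A : ℂ, A = e * ((2 * (c * r x) * T - 1 / √Real.pi) * (c * L v)) +
      T * (e * (Complex.I * ω * N v)) →
      ‖A‖ ≤ (3 / 2 * (‖ω‖ + 2 * ‖c‖ ^ 2) + ‖c‖) * ((1 + (√‖x‖)⁻¹) * W) * ‖v‖ := by
    rintro A rfl
    -- Regrouped so that `T` occurs only in `e * T`, which decays, and the factor `r` only next to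
    -- `L v`, where `|r| ≤ √ρ` cancels `ρ^{-1/2}`. The middle term keeps the singularity `ρ^{-1/2}`.
    have hre : e * ((2 * (c * r x) * T - 1 / √Real.pi) * (c * L v)) +
        T * (e * (Complex.I * ω * N v)) =
        2 * c ^ 2 * (e * T) * (r x * L v) - c * (1 / √Real.pi) * e * L v +
          Complex.I * ω * (e * T) * N v := by ring
    rw [hre]
    refine (norm_add_le _ _).trans ((add_le_add_left (norm_sub_le _ _) _).trans ?_)
    simp only [norm_mul, norm_pow, Complex.norm_I, Complex.norm_ofNat, one_mul] at *
    have hW0 : 0 < W := Real.exp_pos _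
    have b1 : 2 * ‖c‖ ^ 2 * (‖e‖ * ‖T‖) * (‖(r x : ℂ)‖ * ‖(L v : ℂ)‖) ≤
        2 * ‖c‖ ^ 2 * (3 / 2 * W) * ‖v‖ := by gcongr
    have b2 : ‖c‖ * ‖(1 / √Real.pi : ℂ)‖ * ‖e‖ * ‖(L v : ℂ)‖ ≤
        ‖c‖ * 1 * W * ((√‖x‖)⁻¹ * ‖v‖) := by gcongr
    have b3 : ‖ω‖ * (‖e‖ * ‖T‖) * ‖(N v : ℂ)‖ ≤ ‖ω‖ * (3 / 2 * W) * ‖v‖ := by gcongr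
    have b4 : 0 ≤ (3 / 2 * (‖ω‖ + 2 * ‖c‖ ^ 2)) * ((√‖x‖)⁻¹ * W) * ‖v‖ + ‖c‖ * W * ‖v‖ := by
      positivity
    nlinarith
  refine expand _ ?_
  simp [e, T, mul_comm, mul_left_comm]


theorem memH1_transformedWave {α : ℝ} (hα : Real.pi / 2 < α) (hα' : α < Real.pi) {F : ℝ → ℂ}
    (hF : IsTame F) {ω : ℂ} (hω : 0 < ω.im) : MemH1 Q (transformedWave α F ω) := by
  set κ := -Real.cos α with hκ
  have hκ0 : 0 < κ := neg_cos_pos hα hα'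
  have hκ1 : κ ≤ 1 := by rw [hκ]; linarith [Real.neg_one_le_cos α]
  have hb : 0 < ω.im * κ := mul_pos hω hκ0
  have hw := (memLp_two_radial hb).restrict Q
  have hsm : ContDiffOn ℝ 1 (transformedWave α F ω) Q :=
    ((contDiffOn_transformedWave α hF).of_le le_top).comp (f := fun x => (ω, x)) (by fun_prop)
      fun x hx => ⟨hω, hx⟩
  have hQm : MeasurableSet Q := isOpen_Q.measurableSet
  set S := ‖signalTransform F ω‖
  set A := 3 / 2 * (‖ω‖ + 2 * ‖waveRoot ω‖ ^ 2) + ‖waveRoot ω‖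
  have habs : ∀ θ, ∀ x ∈ Q, |edgeCoord θ x| ≤ √‖x‖ := fun θ x hx => by
    rw [edgeCoord_eq θ hx, abs_mul, abs_of_nonneg (Real.sqrt_nonneg _)]
    exact mul_le_of_le_one_right (Real.sqrt_nonneg _) (Real.abs_sin_le_one _)
  have hnorm : ∀ x : Plane, ‖(1 + (√‖x‖)⁻¹) * Real.exp (-(ω.im * κ) * ‖x‖)‖ =
      (1 + (√‖x‖)⁻¹) * Real.exp (-(ω.im * κ) * ‖x‖) := fun x =>
    Real.norm_of_nonneg (by positivity)
  refine memH1_of_contDiffOn isOpen_Q hsm ?_ fun k => ?_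
  · refine hw.of_le_mul (c := S * 3) (hsm.continuousOn.aestronglyMeasurable hQm) ?_
    filter_upwards [ae_restrict_mem hQm] with x hx
    rw [transformedWave, norm_mul, hnorm, mul_assoc S]
    refine mul_le_mul_of_nonneg_left ?_ (norm_nonneg (signalTransform F ω))
    have h1 := norm_exp_mul_transition_le hω hκ1 (norm_nonneg x)
      (neg_cos_mul_norm_le_phiPlus hα hα' hx)
    have h2 := norm_exp_mul_transition_le hω hκ1 (norm_nonneg x)
      (neg_cos_mul_norm_le_phiMinus hα hα' hx)
    refine (norm_add_le (_ : ℂ) _).trans ((add_le_add h1 h2).trans ?_)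
    have h3 : 0 ≤ (√‖x‖)⁻¹ * Real.exp (-(ω.im * κ) * ‖x‖) := by positivity
    nlinarith
  · refine hw.of_le_mul (c := S * (2 * A))
      (((hsm.continuousOn_fderiv_of_isOpen isOpen_Q le_rfl).clm_apply
        continuousOn_const).aestronglyMeasurable hQm) ?_
    filter_upwards [ae_restrict_mem hQm] with x hx
    have hx0 : x ≠ 0 := norm_pos_iff.1 (norm_pos_of_mem_Q hx)
    obtain ⟨L₁, hL₁, hn₁⟩ := hasFDerivAt_edgeCoord (phiPlus α) hx
    obtain ⟨L₂, hL₂, hn₂⟩ := hasFDerivAt_edgeCoord (phiMinus α) hx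
    obtain ⟨D₁, hD₁, hb₁⟩ := hasFDerivAt_exp_mul_transition hω hκ1 hx0 hL₁ hn₁ (habs _ x hx)
      (neg_cos_mul_norm_le_phiPlus hα hα' hx)
    obtain ⟨D₂, hD₂, hb₂⟩ := hasFDerivAt_exp_mul_transition hω hκ1 hx0 hL₂.neg
      (by rwa [norm_neg]) (by simpa only [Pi.neg_apply, abs_neg] using habs _ x hx)
      (neg_cos_mul_norm_le_phiMinus hα hα' hx)
    have hD : HasFDerivAt (transformedWave α F ω) (signalTransform F ω • (D₁ + D₂)) x :=
      (hD₁.add hD₂).const_mul _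
    rw [hD.fderiv, hnorm]
    refine (ContinuousLinearMap.le_opNorm _ _).trans ?_
    rw [PiLp.norm_single, norm_one, mul_one, norm_smul, mul_assoc S]
    refine mul_le_mul_of_nonneg_left ((norm_add_le _ _).trans ?_) (norm_nonneg _)
    have hb : ‖D₁‖ + ‖D₂‖ ≤ A * _ + A * _ := add_le_add hb₁ hb₂
    linarith

/-! ### Passing to a Borel representative of the profile -/

theorem norm_modulated (ω₀ : ℝ) (f : ℝ → ℂ) (s : ℝ) : ‖modulated ω₀ f s‖ = ‖f s‖ := by
  rw [modulated, norm_mul, Complex.norm_exp]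
  simp

theorem IsTame.modulated {f : ℝ → ℂ} (hf : IsTame f) (ω₀ : ℝ) : IsTame (modulated ω₀ f) := by
  obtain ⟨C, hC, N, h⟩ := hf.growth
  refine ⟨hf.measurable.mul (by fun_prop), fun s hs => ?_, C, hC, N, fun s => ?_⟩
  · rw [HalfPlaneDiffraction.modulated, hf.eq_zero_of_neg s hs, zero_mul]
  · rw [norm_modulated]; exact h s

theorem IsProfile.exists_isTame {f : ℝ → ℂ} (hf : IsProfile f) :
    ∃ g : ℝ → ℂ, IsTame g ∧ ∀ᵐ s, f s = g s := by
  obtain ⟨p, B, hB⟩ := hf.bounded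
  have hB' : ∀ s, (1 + |s|) ^ p * ‖f s‖ ≤ B := fun s => hB ⟨s, rfl⟩
  have hB0 : 0 ≤ B := le_trans (by positivity) (hB' 0)
  -- The real weight `(1 + |s|)^p` becomes growth with a natural exponent; `N = 0` when `p ≥ 0`.
  set N := ⌈-p⌉₊
  have hfb : ∀ s, ‖f s‖ ≤ B * (1 + |s|) ^ N := fun s => by
    have h1 : (1 : ℝ) ≤ 1 + |s| := by linarith [abs_nonneg s]
    have h0 : (0 : ℝ) < 1 + |s| := by linarith
    have h2 : (1 + |s|) ^ (-p) ≤ (1 + |s|) ^ N := by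
      rw [← Real.rpow_natCast]
      exact Real.rpow_le_rpow_of_exponent_le h1 (Nat.le_ceil _)
    have h3 : ‖f s‖ = (1 + |s|) ^ p * ‖f s‖ * (1 + |s|) ^ (-p) := by
      rw [mul_right_comm, ← Real.rpow_add h0]
      simp
    rw [h3]
    exact mul_le_mul (hB' s) h2 (by positivity) hB0
  obtain ⟨m, hm, hfm⟩ := hf.locallyIntegrable.aestronglyMeasurable
  -- Cutting the measurable representative off outside `S` makes causality and growth hold
  -- everywhere; almost everywhere nothing changes, as `f` itself satisfies both.
  set S : Set ℝ := {s | 0 ≤ s} ∩ {s | ‖m s‖ ≤ B * (1 + |s|) ^ N} with hS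
  have hSm : MeasurableSet S :=
    (measurableSet_le measurable_const measurable_id).inter
      (measurableSet_le hm.measurable.norm (by fun_prop))
  refine ⟨S.indicator m, ⟨hm.measurable.indicator hSm, fun s hs => ?_, B, hB0, N, fun s => ?_⟩, ?_⟩
  · exact indicator_of_notMem (fun h => hs.not_ge h.1) _
  · by_cases h : s ∈ S
    · rw [indicator_of_mem h]; exact h.2
    · rw [indicator_of_notMem h, norm_zero]; positivity
  · filter_upwards [hfm] with s hs
    by_cases h : s ∈ S
    · rw [indicator_of_mem h, hs]
    · rw [indicator_of_notMem h]
      refine hf.eq_zero_of_neg s (not_le.1 fun h0 => h ⟨h0, ?_⟩)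
      change ‖m s‖ ≤ _
      rw [← hs]
      exact hfb s

/-- The measure of the image is the integral of `|g'|` over `S`, and `|g'|` is positive there. -/
theorem volume_eq_zero_of_volume_image_eq_zero {g g' : ℝ → ℝ} {S : Set ℝ} (hS : MeasurableSet S)
    (hg : ∀ x ∈ S, HasDerivAt g (g' x) x) (hg' : Measurable g') (hne : ∀ x ∈ S, g' x ≠ 0)
    (hinj : InjOn g S) (h : volume (g '' S) = 0) : volume S = 0 := by
  have h1 := lintegral_image_eq_lintegral_abs_deriv_mul hS
    (fun x hx => (hg x hx).hasDerivWithinAt) hinj (fun _ => 1)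
  rw [setLIntegral_one, h] at h1
  have h2 := (lintegral_eq_zero_iff (by fun_prop)).1 h1.symm
  rw [← Measure.restrict_eq_zero, ← ae_eq_bot, ← eventually_false_iff_eq_bot]
  filter_upwards [h2, ae_restrict_mem hS] with x hx hxS
  simp only [mul_one, Pi.zero_apply, ENNReal.ofReal_eq_zero] at hx
  exact hne x hxS (abs_nonpos_iff.1 hx)

/-- The map `β ↦ t - ρ cosh β` is injective with nonzero derivative on each open half-line; the
critical point `β = 0` is a null set. -/
theorem ae_comp_cosh {P : ℝ → Prop} (hP : ∀ᵐ s, P s) {ρ : ℝ} (hρ : 0 < ρ) (t : ℝ) :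
    ∀ᵐ β : ℝ, P (t - ρ * Real.cosh β) := by
  obtain ⟨N, hN, hNm, hN0⟩ := exists_measurable_superset_of_null (ae_iff.1 hP)
  have hd : ∀ β : ℝ, HasDerivAt (fun β : ℝ => t - ρ * Real.cosh β) (-(ρ * Real.sinh β)) β :=
    fun β => ((Real.hasDerivAt_cosh β).const_mul ρ).const_sub t
  have hpre : MeasurableSet ((fun β : ℝ => t - ρ * Real.cosh β) ⁻¹' N) :=
    hNm.preimage (by fun_prop)
  have main : ∀ H : Set ℝ, MeasurableSet H → (∀ β ∈ H, β ≠ 0) → InjOn Real.cosh H →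
      volume ((fun β : ℝ => t - ρ * Real.cosh β) ⁻¹' N ∩ H) = 0 := fun H hH h0 hinj => by
    refine volume_eq_zero_of_volume_image_eq_zero (hpre.inter hH) (fun β _ => hd β)
      (by fun_prop) (fun β hβ => ?_) (fun a ha b hb hab => hinj ha.2 hb.2 ?_)
      (measure_mono_null (image_subset_iff.2 fun β hβ => hβ.1) hN0)
    · exact neg_ne_zero.2 (mul_ne_zero hρ.ne' (Real.sinh_ne_zero.2 (h0 β hβ.2)))
    · have : ρ * Real.cosh a = ρ * Real.cosh b := by simpa using hab
      exact mul_left_cancel₀ hρ.ne' this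
  have habs : ∀ a b : ℝ, Real.cosh a = Real.cosh b → |a| = |b| := fun a b hab =>
    le_antisymm (Real.cosh_le_cosh.1 hab.le) (Real.cosh_le_cosh.1 hab.ge)
  have h1 := main (Ioi 0) measurableSet_Ioi (fun β hβ => (mem_Ioi.1 hβ).ne') fun a ha b hb hab => by
    have := habs a b hab
    rwa [abs_of_pos ha, abs_of_pos hb] at this
  have h2 := main (Iio 0) measurableSet_Iio (fun β hβ => (mem_Iio.1 hβ).ne) fun a ha b hb hab => by
    have := habs a b hab
    rw [abs_of_neg ha, abs_of_neg hb] at this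
    exact neg_injective this
  refine measure_mono_null (fun β hβ => ?_)
    (measure_union_null (measure_union_null h1 h2) (measure_singleton (0 : ℝ)))
  have hβN : t - ρ * Real.cosh β ∈ N := hN hβ
  rcases lt_trichotomy β 0 with h | h | h
  · exact Or.inl (Or.inr ⟨hβN, h⟩)
  · exact Or.inr h
  · exact Or.inl (Or.inl ⟨hβN, h⟩)

theorem diffractedWave_congr (α ω₀ : ℝ) {f g : ℝ → ℂ} (h : ∀ᵐ s, f s = g s) {x : Plane}
    (hx : x ∈ Q) (t : ℝ) : diffractedWave α ω₀ f x t = diffractedWave α ω₀ g x t := by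
  rw [diffractedWave, diffractedWave]
  congr 1
  refine integral_congr_ae ?_
  filter_upwards [ae_comp_cosh h (norm_pos_of_mem_Q hx) t] with β hβ
  rw [modulated, modulated, hβ]

/-- The diffracted wave sees only the almost-everywhere class of the profile, whereas the plane
waves evaluate it at two specific times. -/
theorem scatteredWave_congr (α ω₀ : ℝ) {f g : ℝ → ℂ} (h : ∀ᵐ s, f s = g s) {x : Plane}
    (hx : x ∈ Q) {t : ℝ} (h₁ : f (t - incidentPhase α x) = g (t - incidentPhase α x))
    (h₂ : f (t - reflectedPhase α x) = g (t - reflectedPhase α x)) :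
    scatteredWave α ω₀ f x t = scatteredWave α ω₀ g x t := by
  simp only [scatteredWave, totalWave, screenedIncidentWave, incidentWave, reflectedWave,
    diffractedWave_congr α ω₀ h hx t, modulated, h₁, h₂]

theorem quasiMeasurePreserving_sub_const (a : ℝ) :
    Measure.QuasiMeasurePreserving (fun t : ℝ => t - a) volume volume :=
  (measurePreserving_sub_right volume a).quasiMeasurePreserving

theorem ae_scatteredWave_eq (α ω₀ : ℝ) {f g : ℝ → ℂ} (h : ∀ᵐ s, f s = g s) {x : Plane}
    (hx : x ∈ Q) : ∀ᵐ t, scatteredWave α ω₀ f x t = scatteredWave α ω₀ g x t := by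
  filter_upwards [(quasiMeasurePreserving_sub_const (incidentPhase α x)).ae h,
    (quasiMeasurePreserving_sub_const (reflectedPhase α x)).ae h] with t h₁ h₂
  exact scatteredWave_congr α ω₀ h hx h₁ h₂

theorem measurable_incidentPhase (α : ℝ) : Measurable (incidentPhase α) := by
  unfold incidentPhase
  fun_prop

theorem measurable_reflectedPhase (α : ℝ) : Measurable (reflectedPhase α) := by
  unfold reflectedPhase
  fun_prop

theorem ae_prod_scatteredWave_eq (α ω₀ : ℝ) {f g : ℝ → ℂ} (h : ∀ᵐ s, f s = g s) :
    ∀ᵐ z : Plane × ℝ, scatteredWave α ω₀ f z.1 z.2 = scatteredWave α ω₀ g z.1 z.2 := by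
  have key : ∀ a : Plane → ℝ, Measurable a → ∀ᵐ z : Plane × ℝ, f (z.2 - a z.1) = g (z.2 - a z.1) :=
    fun a ha => by
      have hq : Measure.QuasiMeasurePreserving (fun z : Plane × ℝ => z.2 - a z.1)
          (volume.prod volume) volume :=
        QuasiMeasurePreserving.prod_of_right (measurable_snd.sub (ha.comp measurable_fst))
          (Eventually.of_forall fun x => quasiMeasurePreserving_sub_const (a x))
      exact hq.ae h
  have hQ : ∀ᵐ z : Plane × ℝ, z.1 ∈ Q := Measure.quasiMeasurePreserving_fst.ae ae_mem_Q
  filter_upwards [key _ (measurable_incidentPhase α), key _ (measurable_reflectedPhase α), hQ]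
    with z h₁ h₂ hz
  exact scatteredWave_congr α ω₀ h hz h₁ h₂

theorem measurable_kernelZ (α : ℝ) : Measurable (kernelZ α) := by
  have hc : Measurable coth := Complex.measurable_cosh.div Complex.measurable_sinh
  have hU : Measurable (kernelU α) :=
    (hc.comp (by fun_prop)).sub (hc.comp (by fun_prop))
  exact ((hU.comp (by fun_prop)).neg).add (hU.comp (by fun_prop))

theorem measurable_scatteredWave (α ω₀ : ℝ) {g : ℝ → ℂ} (hg : IsTame g) :
    Measurable fun z : Plane × ℝ => scatteredWave α ω₀ g z.1 z.2 := by
  have hF := (hg.modulated ω₀).measurable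
  have hφ : Measurable fun z : Plane × ℝ => polarAngle z.1 :=
    measurable_polarAngle.comp measurable_fst
  have hi : Measurable fun z : Plane × ℝ => incidentWave α ω₀ g z.1 z.2 :=
    hF.comp (measurable_snd.sub ((measurable_incidentPhase α).comp measurable_fst))
  have hr : Measurable fun z : Plane × ℝ => modulated ω₀ g (z.2 - reflectedPhase α z.1) :=
    hF.comp (measurable_snd.sub ((measurable_reflectedPhase α).comp measurable_fst))
  have hs : Measurable fun z : Plane × ℝ => screenedIncidentWave α ω₀ g z.1 z.2 :=
    Measurable.ite (measurableSet_lt hφ measurable_const) hi measurable_const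
  have hr' : Measurable fun z : Plane × ℝ => reflectedWave α ω₀ g z.1 z.2 :=
    Measurable.ite (measurableSet_lt hφ measurable_const) hr.neg measurable_const
  have hφ' : Measurable fun p : (Plane × ℝ) × ℝ => polarAngle p.1.1 :=
    hφ.comp measurable_fst
  have hk : Measurable fun p : (Plane × ℝ) × ℝ =>
      kernelZ α (p.2 + 2 * Real.pi * Complex.I - Complex.I * polarAngle p.1.1) *
        modulated ω₀ g (p.1.2 - ‖p.1.1‖ * Real.cosh p.2) :=
    ((measurable_kernelZ α).comp (by fun_prop)).mul (hF.comp (by fun_prop))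
  have hd : Measurable fun z : Plane × ℝ => diffractedWave α ω₀ g z.1 z.2 :=
    measurable_const.mul (hk.stronglyMeasurable.integral_prod_right' (ν := volume)).measurable
  exact ((hs.add hr').add hd).sub hi

/-! ### The scattered wave as a tempered distribution and its transform. -/

theorem ae_regular_direction (α : ℝ) : ∀ᵐ x : Plane,
    x ∈ Q ∧ polarAngle x ≠ phiPlus α ∧ polarAngle x ≠ phiMinus α := by
  filter_upwards [ae_mem_Q, ae_polarAngle_ne (phiPlus α), ae_polarAngle_ne (phiMinus α)]
    with x h₁ h₂ h₃
  exact ⟨h₁, h₂, h₃⟩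

theorem exists_scattered_distribution {α ω₀ : ℝ} (hα : Real.pi / 2 < α) (hα' : α < Real.pi)
    {f g : ℝ → ℂ} (hg : IsTame g) (hfg : ∀ᵐ s, f s = g s) :
    ∃ T : 𝓢'(Plane × ℝ, ℂ), IsRegularDistribution T (scatteredWave α ω₀ f) := by
  obtain ⟨C, hC, N, h⟩ := (hg.modulated ω₀).norm_le
  have hae := ae_prod_scatteredWave_eq α ω₀ hfg
  have hm : AEStronglyMeasurable (fun z : Plane × ℝ => scatteredWave α ω₀ f z.1 z.2) volume :=
    (measurable_scatteredWave α ω₀ hg).aestronglyMeasurable.congr (hae.mono fun z hz => hz.symm)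
  have hdir : ∀ᵐ z : Plane × ℝ,
      z.1 ∈ Q ∧ polarAngle z.1 ≠ phiPlus α ∧ polarAngle z.1 ≠ phiMinus α :=
    Measure.quasiMeasurePreserving_fst.ae (ae_regular_direction α)
  -- Supplies the temperate growth of the measure.
  have : (volume : Measure (Plane × ℝ)).IsAddHaarMeasure :=
    inferInstanceAs ((volume : Measure Plane).prod (volume : Measure ℝ)).IsAddHaarMeasure
  refine exists_temperedDistribution_of_polynomial_growth volume hm (C := 4 * C) (N := N)
    (by positivity) ?_
  filter_upwards [hae, hdir] with z hz ⟨h₁, h₂, h₃⟩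
  rw [hz]
  refine (norm_scatteredWave_le hα hα' (hg.modulated ω₀) h₁ h₂ h₃ fun s hs => h s z.2 hs).trans ?_
  rw [mul_assoc]
  have : |z.2| ≤ ‖z‖ := norm_snd_le z
  gcongr

theorem isSupportedInFuture_scattered {α ω₀ : ℝ} (hα : Real.pi / 2 < α) (hα' : α < Real.pi)
    {f g : ℝ → ℂ} (hg : IsTame g) (hfg : ∀ᵐ s, f s = g s) {T : 𝓢'(Plane × ℝ, ℂ)}
    (hT : IsRegularDistribution T (scatteredWave α ω₀ f)) : IsSupportedInFuture Q T := by
  intro Φ hΦ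
  rw [(hT Φ).2]
  have hdir : ∀ᵐ z : Plane × ℝ,
      z.1 ∈ Q ∧ polarAngle z.1 ≠ phiPlus α ∧ polarAngle z.1 ≠ phiMinus α :=
    Measure.quasiMeasurePreserving_fst.ae (ae_regular_direction α)
  refine integral_eq_zero_of_ae ?_
  filter_upwards [ae_prod_scatteredWave_eq α ω₀ hfg, hdir] with z hz ⟨h₁, h₂, h₃⟩
  rcases lt_or_ge z.2 0 with h | h
  · rw [hz, scatteredWave_eq_zero_of_neg hα hα' (hg.modulated ω₀) h₁ h₂ h₃ h, zero_mul,
      Pi.zero_apply]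
  · have : Φ z = 0 := image_eq_zero_of_notMem_tsupport fun hz' =>
      hΦ hz' ⟨subset_closure h₁, h⟩
    rw [this, mul_zero, Pi.zero_apply]

/-- Fubini in `(x, t)`: causality removes `t < 0`, and for `t ≥ 0` every admissible `Φ` equals `ψ(x)
e^{iωt}`, so the choice of its extension is irrelevant. -/
theorem hasFourierLaplace_scattered {α ω₀ : ℝ} (hα : Real.pi / 2 < α) (hα' : α < Real.pi)
    {f g : ℝ → ℂ} (hg : IsTame g) (hfg : ∀ᵐ s, f s = g s) {T : 𝓢'(Plane × ℝ, ℂ)}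
    (hT : IsRegularDistribution T (scatteredWave α ω₀ f)) {ω : ℂ} (hω : 0 < ω.im) :
    HasFourierLaplace Q T ω (transformedWave α (modulated ω₀ g) ω) := by
  rintro ψ Φ ⟨δ, hδ, hΦ⟩
  obtain ⟨hi, hTΦ⟩ := hT Φ
  rw [hTΦ, restrict_Q, Measure.volume_eq_prod, integral_prod _ hi]
  refine integral_congr_ae ?_
  filter_upwards [ae_regular_direction α] with x ⟨h₁, h₂, h₃⟩
  rw [← (integrable_cexp_mul_scatteredWave hα hα' (hg.modulated ω₀) h₁ h₂ h₃ hω).2,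
    ← integral_mul_const]
  refine integral_congr_ae ?_
  filter_upwards [ae_scatteredWave_eq α ω₀ hfg h₁] with t ht
  rw [ht]
  rcases lt_or_ge t 0 with h | h
  · rw [scatteredWave_eq_zero_of_neg hα hα' (hg.modulated ω₀) h₁ h₂ h₃ h]
    ring
  · rw [hΦ x t (by linarith)]
    ring

end HalfPlaneDiffraction
end

open HalfPlaneDiffraction
theorem mainTheorem2 (α ω₀ : ℝ) (hα : Real.pi / 2 < α) (hα' : α < Real.pi) (hω₀ : 0 < ω₀)
    (f : ℝ → ℂ) (hf : IsProfile f) :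
    (∀ ω : ℂ, 0 < ω.im →
      (∀ x ∈ Q, polarAngle x ≠ phiPlus α → polarAngle x ≠ phiMinus α →
        IntegrableOn
          (fun t : ℝ => Complex.exp (Complex.I * ω * t) * scatteredWave α ω₀ f x t) (Ioi 0)) ∧
      MemH1 Q (fun x => fourierLaplace (scatteredWave α ω₀ f x) ω)) ∧
    ∃ T ∈ solutionClass, IsRegularDistribution T (scatteredWave α ω₀ f) := by
  obtain ⟨g, hg, hfg⟩ := hf.exists_isTame
  have hF := hg.modulated ω₀
  refine ⟨fun ω hω => ⟨fun x hx h₁ h₂ => ?_, ?_⟩, ?_⟩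
  · have hi := (integrable_cexp_mul_scatteredWave hα hα' hF hx h₁ h₂ hω).1
    refine (hi.congr ?_).integrableOn
    filter_upwards [ae_scatteredWave_eq α ω₀ hfg hx] with t ht
    rw [ht]
  -- The critical rays form a null set, so the values of the transform on them do not affect `H¹`
  -- membership.
  · refine memH1_congr ?_ (memH1_transformedWave hα hα' hF hω)
    rw [restrict_Q]
    filter_upwards [ae_regular_direction α] with x ⟨hx, h₁, h₂⟩
    rw [← fourierLaplace_scatteredWave hα hα' hF hx h₁ h₂ hω]
    refine integral_congr_ae (ae_restrict_of_ae ?_)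
    filter_upwards [ae_scatteredWave_eq α ω₀ hfg hx] with t ht
    rw [ht]
  · obtain ⟨T, hT⟩ := exists_scattered_distribution (ω₀ := ω₀) hα hα' hg hfg
    exact ⟨T, ⟨isSupportedInFuture_scattered hα hα' hg hfg hT,
      transformedWave α (modulated ω₀ g),
      fun ω hω => hasFourierLaplace_scattered hα hα' hg hfg hT hω,
      isHolomorphicIntoC2_transformedWave α hF,
      fun ω hω => memH1_transformedWave hα hα' hF hω⟩, hT⟩
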